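/- A map $f:[0,1]\to\mathbb R$ is of class $C^s$, $1<s<\infty$, if, writing $s=r+\alpha$ with $r\ge 1$ an integer and $0<\alpha\le 1$, it is $r$ times continuously differentiable and $f^{(r)}$ is $\alpha$-Hölder; $C^1$, $C^\infty$ and $C^\omega$ (real analytic) have their usual meaning. A hyperbolic IFS of class $C^s$ is a pair $\Phi=\{f_0,f_1\}$ of $C^s$ maps on $[0,1]$ with $0<\inf|f_i'|\le\sup|f_i'|<1$ and $0=f_0(0)<f_0(1)<f_1(0)<f_1(1)=1$. Its attractor, i.e. the nonempty compact $X\subseteq[0,1]$ with $X=f_0(X)\cup f_1(X)$, is called a hyperbolic Cantor set of class $C^s$. For a finite word $w=w_1\cdots w_n$ in $\{0,1\}$ put $X_w=f_{w_1}\circ\cdots\circ f_{w_n}(X)$, $r_i(w)=\operatorname{diam}X_{wi}/\operatorname{diam}X_w$ for $i=0,1$, and $r_{gap}(w)=1-r_0(w)-r_1(w)$. The scaling function of $X$ (with respect to $\Phi$) is $$\rho(\cdots y_{-2}y_{-1})=\lim_{n\to\infty}\big(r_0,r_{gap},r_1\big)(y_{-n}\cdots y_{-1}),$$ provided that the limit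 exists for every left-infinite sequence $y$. Let $0<\lambda<1/2$. For $1\le s\le\infty$ or $s=\omega$, let $\mathcal E_\lambda^s$ be the collection of all hyperbolic Cantor sets that are attractors of a hyperbolic IFS of class $C^s$ with respect to which the scaling function exists and is the constant $(\lambda,1-2\lambda,\lambda)$. Call two elements $X,Y$ of $\mathcal E_\lambda^s$ $C^s$-equivalent if $h(X)=Y$ for some orientation preserving $C^s$-diffeomorphism $h$ of $[0,1]$. Let $X_\lambda$ be the attractor of $\{\lambda x,\ \lambda x+1-\lambda\}$, and let $[X_\lambda]_s\subseteq\mathcal E_\lambda^s$ be its $C^s$-equivalence class. Then, for all $1<s<t<\infty$, $$\mathcal E_\lambda^\omega\subsetneq\mathcal E_\lambda^\infty\subsetneq\mathcal E_\lambda^t\subsetneq\mathcal E_\lambda^s\subsetneq\mathcal E_\lambda^1 \qquad\text{and}\qquad [X_\lambda]_\omega\subsetneq[X_\lambda]_\infty\subsetneq[X_\lambda]_t\subsetneq[X_\lambda]_s\subsetneq[X_\lambda]_1 .$$ Moreover, a constant scaling function does not force higher regularity: for all $1<s<t<\infty$ some $X\in\mathcal E_\lambda^s$ is not a hyperbolic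 Cantor set of class $C^t$, i.e. it is not the attractor of any hyperbolic IFS of class $C^t$. -/

import Mathlib

open Set Filter Topology
open scoped ContDiff

namespace HyperbolicCantor

/-- The unit interval `[0,1]`. -/
abbrev I : Set ℝ := Icc (0 : ℝ) 1

/-- Regularity indices: a finite index `s` (meaningful for `1 ≤ s < ∞`), `∞`, or `ω`. -/
inductive Regularity : Type
  | finite (s : ℝ)
  | smooth
  | analytic

/-- `f` is `α`-Hölder on `[0,1]`. -/
def IsHolder (α : ℝ) (f : ℝ → ℝ) : Prop :=
  ∃ A : ℝ, 0 < A ∧ ∀ t ∈ I, ∀ u ∈ I, |f u - f t| ≤ A * |u - t| ^ α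

/-- `f` is of class `C^s` on `[0,1]` (values of `f` off `[0,1]` are irrelevant).
`C^1` has its usual meaning; for `1 < s < ∞` write `s = r + α` with `r ≥ 1` an integer and
`0 < α ≤ 1` (such a pair is unique): then `f` is `r` times continuously differentiable and its
`r`-th derivative is `α`-Hölder.  In particular index `2` means `C^{1,1}`. -/
def IsOfClass : Regularity → (ℝ → ℝ) → Prop
  | .finite s, f =>
      (s = 1 ∧ ContDiffOn ℝ 1 f I) ∨
      ∃ (r : ℕ) (α : ℝ), 1 ≤ r ∧ 0 < α ∧ α ≤ 1 ∧ s = r + α ∧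
        ContDiffOn ℝ r f I ∧ IsHolder α (iteratedDerivWithin r f I)
  | .smooth, f => ContDiffOn ℝ ∞ f I
  | .analytic, f => AnalyticOn ℝ f I

/-- `{f 0, f 1}` is a hyperbolic iterated function system of class `C^s` on `[0,1]`. -/
structure IsHyperbolicIFS (s : Regularity) (f : Fin 2 → ℝ → ℝ) : Prop where
  isOfClass : ∀ i, IsOfClass s (f i)
  /-- `0 < inf |f_i'| ≤ sup |f_i'| < 1` on `[0,1]`. -/
  deriv_bounds : ∀ i, ∃ m M : ℝ, 0 < m ∧ M < 1 ∧
    ∀ t ∈ I, m ≤ |derivWithin (f i) I t| ∧ |derivWithin (f i) I t| ≤ M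
  zero_zero : f 0 0 = 0
  zero_one_pos : 0 < f 0 1
  separated : f 0 1 < f 1 0
  one_zero_lt : f 1 0 < f 1 1
  one_one : f 1 1 = 1

/-- `X` is the attractor of `{f 0, f 1}`: the nonempty compact subset of `[0,1]` with
`X = f 0 (X) ∪ f 1 (X)`. -/
structure IsAttractor (f : Fin 2 → ℝ → ℝ) (X : Set ℝ) : Prop where
  subset : X ⊆ I
  nonempty : X.Nonempty
  isCompact : IsCompact X
  invariant : X = f 0 '' X ∪ f 1 '' X

/-- `X` is a hyperbolic Cantor set of class `C^s`. -/
def IsHyperbolicCantorSet (s : Regularity) (X : Set ℝ) : Prop :=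
  ∃ f : Fin 2 → ℝ → ℝ, IsHyperbolicIFS s f ∧ IsAttractor f X

/-- The composition `f_{w_1} ∘ ⋯ ∘ f_{w_n}` for a finite word `w = w_1 ⋯ w_n`. -/
def wordMap (f : Fin 2 → ℝ → ℝ) : List (Fin 2) → ℝ → ℝ
  | [] => id
  | i :: w => f i ∘ wordMap f w

/-- The cylinder `X_w` of the attractor `X`: the points of `X` whose coding begins with `w`. -/
def cylinder (f : Fin 2 → ℝ → ℝ) (X : Set ℝ) (w : List (Fin 2)) : Set ℝ :=
  wordMap f w '' X

/-- The ratios `r(w) = (r_0(w), r_gap(w), r_1(w))`. -/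
noncomputable def ratio (f : Fin 2 → ℝ → ℝ) (X : Set ℝ) (w : List (Fin 2)) : ℝ × ℝ × ℝ :=
  let d := Metric.diam (cylinder f X w)
  let d₀ := Metric.diam (cylinder f X (w ++ [0]))
  let d₁ := Metric.diam (cylinder f X (w ++ [1]))
  (d₀ / d, 1 - (d₀ + d₁) / d, d₁ / d)

/-- A point `⋯ y_{-2} y_{-1}` of the dual Cantor set is stored as `y : ℕ → Fin 2`, where `y k` is
the letter `y_{-(k+1)}`.  This is the finite word `y_{-n} ⋯ y_{-1}`. -/
def dualWord (y : ℕ → Fin 2) (n : ℕ) : List (Fin 2) :=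
  ((List.range n).map y).reverse

/-- `ρ` is the scaling function of the attractor `X` of `{f 0, f 1}`: for every point `y` of the
dual Cantor set, `r(y_{-n} ⋯ y_{-1})` converges to `ρ y` as `n → ∞`. -/
def HasScalingFunction (f : Fin 2 → ℝ → ℝ) (X : Set ℝ) (ρ : (ℕ → Fin 2) → ℝ × ℝ × ℝ) : Prop :=
  ∀ y : ℕ → Fin 2, Tendsto (fun n : ℕ => ratio f X (dualWord y n)) atTop (𝓝 (ρ y))

/-- The hyperbolic Cantor sets of class `C^s` with constant scaling function
`(lam, 1 - 2 lam, lam)`. -/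
def E (lam : ℝ) (s : Regularity) : Set (Set ℝ) :=
  {X | ∃ f : Fin 2 → ℝ → ℝ, IsHyperbolicIFS s f ∧ IsAttractor f X ∧
    HasScalingFunction f X (fun _ => (lam, 1 - 2 * lam, lam))}

/-- `X` and `Y` are `C^s`-equivalent: some orientation preserving `C^s`-diffeomorphism `h` of
`[0,1]`, with inverse `k`, maps `X` onto `Y`. -/
def Equivalent (s : Regularity) (X Y : Set ℝ) : Prop :=
  ∃ h k : ℝ → ℝ, IsOfClass s h ∧ IsOfClass s k ∧ MapsTo h I I ∧ MapsTo k I I ∧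
    InvOn k h I I ∧ StrictMonoOn h I ∧ h '' X = Y

/-- The `C^s`-equivalence class of `X` among the hyperbolic Cantor sets of class `C^s` with constant
scaling function `(lam, 1 - 2 lam, lam)`. -/
def equivClass (lam : ℝ) (s : Regularity) (X : Set ℝ) : Set (Set ℝ) :=
  {Y | Y ∈ E lam s ∧ Equivalent s X Y}

/-- The self-similar system `x ↦ lam x`, `x ↦ lam x + (1 - lam)`. -/
def selfSimilarIFS (lam : ℝ) : Fin 2 → ℝ → ℝ :=
  ![fun x => lam * x, fun x => lam * x + (1 - lam)]

end HyperbolicCantor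

namespace HyperbolicCantor

/-! ### Hölder functions on the unit interval -/

/-! Every witness is an image `h '' X` of the self-similar set under a diffeomorphism `h` of
`[0,1]`. Conjugating the affine system by `h` gives a system with attractor `h '' X` and the
regularity of `h`. Its scaling function is the same constant, because a `C^1` map changes length
ratios inside short intervals by a factor close to 1. So `h '' X` lies in the equivalence class of
`X` for the regularity of `h`, and both chains are strict once `h '' X` is the attractor of no
smoother system.

The obstruction is a rigidity at the fixed point 0 (`IsUnitDiffeo.exists_shift`). If `f` generates
`h '' X`, then `g = h⁻¹ ∘ f 0 ∘ h` maps `X` into `X` and has a derivative in `(0,1)` at 0. Relative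
to its left endpoint, a gap starting at a power of `lam` is longer by a definite factor than all
other gaps (`IsAttractor.gap_cases`). As `g` is nearly linear near 0, it sends small powers of `lam`
to powers of `lam`; convergence of `g x / x` then forces `g (lam ^ n) = lam ^ (n + K)` with a fixed
`K ≥ 1` for large `n`.

For finite regularity take `h x = (1 - c) x + c x ^ s` with `s` not an integer. A `C^t` map `f 0`
with `t > s` is a polynomial up to `O(x ^ t)`. In `f 0 (h (lam ^ n)) = h (lam ^ (n + K))` the terms
of order `x` and `x ^ s` require the derivative of `f 0` at 0 to be both `lam ^ K` and `lam ^ (K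
s)`, which is impossible (`not_forall_powers_shift`). For the analytic class take `h` smooth, equal
to the identity on `[0, lam]`, with `h (1 - lam) > 1 - lam`. The identity theorem makes `f 0`
linear, and this puts `1 - lam` into `h '' X`, although it lies in a gap of `h '' X`. -/

theorem uniqueDiffOn_unitInterval : UniqueDiffOn ℝ I := uniqueDiffOn_Icc one_pos

theorem IsHolder.of_bound {α C : ℝ} {f : ℝ → ℝ}
    (h : ∀ t ∈ I, ∀ u ∈ I, |f u - f t| ≤ C * |u - t| ^ α) : IsHolder α f := by
  refine ⟨|C| + 1, by positivity, fun t ht u hu => (h t ht u hu).trans ?_⟩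
  have := le_abs_self C
  gcongr
  linarith

theorem IsHolder.congr {α : ℝ} {f g : ℝ → ℝ} (hf : IsHolder α f) (h : EqOn f g I) :
    IsHolder α g := by
  obtain ⟨A, hA, H⟩ := hf
  exact ⟨A, hA, fun t ht u hu => by rw [← h ht, ← h hu]; exact H t ht u hu⟩

theorem IsHolder.mono {α β : ℝ} {f : ℝ → ℝ} (hf : IsHolder α f) (hβ : 0 < β) (h : β ≤ α) :
    IsHolder β f := by
  obtain ⟨A, hA, H⟩ := hf
  refine ⟨A, hA, fun t ht u hu => (H t ht u hu).trans ?_⟩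
  have h1 : |u - t| ≤ 1 := abs_le.2 ⟨by linarith [hu.1, ht.2], by linarith [hu.2, ht.1]⟩
  gcongr 1
  rcases (abs_nonneg (u - t)).eq_or_lt with h0 | h0
  · rw [← h0, Real.zero_rpow (by linarith), Real.zero_rpow (by linarith)]
  · exact Real.rpow_le_rpow_of_exponent_ge h0 h1 h

theorem IsHolder.continuousOn {α : ℝ} {f : ℝ → ℝ} (hf : IsHolder α f) (hα : 0 < α) :
    ContinuousOn f I := by
  obtain ⟨A, hA, H⟩ := hf
  intro t ht
  have h1 : Tendsto (fun u : ℝ => A * |u - t| ^ α) (𝓝[I] t) (𝓝 0) := by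
    have : ContinuousAt (fun u : ℝ => A * |u - t| ^ α) t := by
      refine continuousAt_const.mul (ContinuousAt.rpow_const ?_ (Or.inr hα.le))
      fun_prop
    have h2 := this.tendsto
    simp only [sub_self, abs_zero, Real.zero_rpow hα.ne', mul_zero] at h2
    exact h2.mono_left nhdsWithin_le_nhds
  rw [ContinuousWithinAt, tendsto_iff_dist_tendsto_zero]
  refine squeeze_zero' (Eventually.of_forall fun _ => dist_nonneg) ?_ h1
  filter_upwards [self_mem_nhdsWithin] with u hu
  exact H t ht u hu

theorem exists_abs_le_of_continuousOn {f : ℝ → ℝ} (hf : ContinuousOn f I) :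
    ∃ C, 0 ≤ C ∧ ∀ x ∈ I, |f x| ≤ C := by
  obtain ⟨C, hC⟩ := isCompact_Icc.exists_bound_of_continuousOn hf
  exact ⟨C, (norm_nonneg _).trans (hC 0 (by simp)), hC⟩

theorem isHolder_const (α c : ℝ) : IsHolder α fun _ => c :=
  ⟨1, one_pos, fun t _ u _ => by simp only [sub_self, abs_zero]; positivity⟩

theorem IsHolder.add {α : ℝ} {f g : ℝ → ℝ} (hf : IsHolder α f) (hg : IsHolder α g) :
    IsHolder α fun x => f x + g x := by
  obtain ⟨A, hA, H⟩ := hf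
  obtain ⟨B, hB, K⟩ := hg
  refine ⟨A + B, by positivity, fun t ht u hu => ?_⟩
  have := abs_add_le (f u - f t) (g u - g t)
  calc |f u + g u - (f t + g t)| = |(f u - f t) + (g u - g t)| := by ring_nf
    _ ≤ _ := this
    _ ≤ _ := by linarith [H t ht u hu, K t ht u hu]

theorem IsHolder.mul {α : ℝ} {f g : ℝ → ℝ} (hα : 0 < α) (hf : IsHolder α f)
    (hg : IsHolder α g) : IsHolder α fun x => f x * g x := by
  obtain ⟨C, hC, hfC⟩ := exists_abs_le_of_continuousOn (hf.continuousOn hα)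
  obtain ⟨D, hD, hgD⟩ := exists_abs_le_of_continuousOn (hg.continuousOn hα)
  obtain ⟨A, hA, H⟩ := hf
  obtain ⟨B, hB, K⟩ := hg
  refine .of_bound (C := C * B + D * A) fun t ht u hu => ?_
  calc |f u * g u - f t * g t| = |f u * (g u - g t) + g t * (f u - f t)| := by ring_nf
    _ ≤ |f u| * |g u - g t| + |g t| * |f u - f t| := by
        rw [← abs_mul, ← abs_mul]; exact abs_add_le _ _
    _ ≤ C * (B * |u - t| ^ α) + D * (A * |u - t| ^ α) := by
        gcongr
        exacts [hfC u hu, K t ht u hu, hgD t ht, H t ht u hu]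
    _ = _ := by ring

theorem IsHolder.inv {α m : ℝ} {f : ℝ → ℝ} (hm : 0 < m) (hfm : ∀ x ∈ I, m ≤ f x)
    (hf : IsHolder α f) : IsHolder α fun x => (f x)⁻¹ := by
  obtain ⟨A, hA, H⟩ := hf
  refine .of_bound (C := A / (m * m)) fun t ht u hu => ?_
  have h1 := hfm t ht
  have h2 := hfm u hu
  have h3 : 0 < f t := by linarith
  have h4 : 0 < f u := by linarith
  rw [inv_sub_inv h4.ne' h3.ne', abs_div, abs_of_pos (mul_pos h4 h3), abs_sub_comm]
  calc |f u - f t| / (f u * f t) ≤ (A * |u - t| ^ α) / (m * m) := by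
        gcongr
        exact H t ht u hu
    _ = _ := by ring

theorem IsHolder.comp {α : ℝ} {f g : ℝ → ℝ} (hα : 0 < α) (hf : IsHolder α f)
    (hg : IsHolder 1 g) (hI : MapsTo g I I) : IsHolder α fun x => f (g x) := by
  obtain ⟨A, hA, H⟩ := hf
  obtain ⟨B, hB, K⟩ := hg
  refine .of_bound (C := A * B ^ α) fun t ht u hu => (H _ (hI ht) _ (hI hu)).trans ?_
  have := K t ht u hu
  rw [Real.rpow_one] at this
  calc A * |g u - g t| ^ α ≤ A * (B * |u - t|) ^ α := by gcongr
    _ = _ := by rw [Real.mul_rpow hB.le (abs_nonneg _)]; ring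

theorem isHolder_one_of_hasDerivWithinAt {f f' : ℝ → ℝ} {C : ℝ}
    (h : ∀ x ∈ I, HasDerivWithinAt f (f' x) I x) (hC : ∀ x ∈ I, |f' x| ≤ C) : IsHolder 1 f := by
  refine .of_bound (C := C) fun t ht u hu => ?_
  rw [Real.rpow_one]
  exact Convex.norm_image_sub_le_of_norm_hasDerivWithin_le h hC (convex_Icc 0 1) ht hu

/-! ### Functions whose `r`-th derivative is Hölder -/

/-- `f` is `r` times differentiable on `[0,1]` and its `r`-th derivative is `α`-Hölder. -/
def HolderDeriv (α : ℝ) : ℕ → (ℝ → ℝ) → Prop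
  | 0, f => IsHolder α f
  | r + 1, f => ∃ f' : ℝ → ℝ, (∀ x ∈ I, HasDerivWithinAt f (f' x) I x) ∧ HolderDeriv α r f'

namespace HolderDeriv

variable {α : ℝ} {r : ℕ} {f g : ℝ → ℝ}

theorem congr (hf : HolderDeriv α r f) (h : EqOn f g I) : HolderDeriv α r g := by
  cases r with
  | zero => exact IsHolder.congr hf h
  | succ r =>
    obtain ⟨f', h1, h2⟩ := hf
    exact ⟨f', fun x hx => (h1 x hx).congr (fun y hy => (h hy).symm) (h hx).symm, h2⟩

theorem continuousOn (hα : 0 < α) (hf : HolderDeriv α r f) : ContinuousOn f I := by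
  cases r with
  | zero => exact IsHolder.continuousOn hf hα
  | succ r =>
    obtain ⟨f', h1, -⟩ := hf
    exact fun x hx => (h1 x hx).continuousWithinAt

theorem isHolder_one (hα : 0 < α) (hf : HolderDeriv α (r + 1) f) : IsHolder 1 f := by
  obtain ⟨f', h1, h2⟩ := hf
  obtain ⟨C, -, hC⟩ := exists_abs_le_of_continuousOn (h2.continuousOn hα)
  exact isHolder_one_of_hasDerivWithinAt h1 hC

/-- A Hölder derivative is bounded on the compact interval, so one order of differentiability buys
exponent 1. With `mono_exponent` this makes the classes decrease in `r + α`. -/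
theorem pred_one (hα : 0 < α) (hf : HolderDeriv α (r + 1) f) : HolderDeriv 1 r f := by
  induction r generalizing f with
  | zero => exact hf.isHolder_one hα
  | succ r ih =>
    obtain ⟨f', h1, h2⟩ := hf
    exact ⟨f', h1, ih h2⟩

theorem mono_exponent {β : ℝ} (hβ : 0 < β) (h : β ≤ α) (hf : HolderDeriv α r f) :
    HolderDeriv β r f := by
  induction r generalizing f with
  | zero => exact IsHolder.mono hf hβ h
  | succ r ih =>
    obtain ⟨f', h1, h2⟩ := hf
    exact ⟨f', h1, ih h2⟩

theorem pred (hα : 0 < α) (hα1 : α ≤ 1) (hf : HolderDeriv α (r + 1) f) : HolderDeriv α r f :=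
  (hf.pred_one hα).mono_exponent hα hα1

theorem of_le {q : ℕ} (hα : 0 < α) (hα1 : α ≤ 1) (hqr : q ≤ r) (hf : HolderDeriv α r f) :
    HolderDeriv α q f := by
  induction r, hqr using Nat.le_induction with
  | base => exact hf
  | succ r _ ih => exact ih (hf.pred hα hα1)

theorem mono {q : ℕ} {β : ℝ} (hα : 0 < α) (hα1 : α ≤ 1) (hβ : 0 < β) (hβ1 : β ≤ 1)
    (h : q + β ≤ r + α) (hf : HolderDeriv α r f) : HolderDeriv β q f := by
  rcases lt_trichotomy q r with hqr | rfl | hqr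
  · exact ((hf.of_le hα hα1 hqr).pred_one hα).mono_exponent hβ hβ1
  · exact hf.mono_exponent hβ (by linarith)
  · have : (r : ℝ) + 1 ≤ q := by exact_mod_cast hqr
    linarith

theorem const (c : ℝ) : HolderDeriv α r fun _ => c := by
  induction r generalizing c with
  | zero => exact isHolder_const α c
  | succ r ih => exact ⟨fun _ => 0, fun x _ => hasDerivWithinAt_const x I c, ih 0⟩

theorem id (hα : 0 < α) (hα1 : α ≤ 1) : HolderDeriv α r fun x => x := by
  cases r with
  | zero =>
    refine IsHolder.mono (α := 1) ⟨1, one_pos, fun t _ u _ => ?_⟩ hα hα1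
    rw [Real.rpow_one, one_mul]
  | succ r => exact ⟨fun _ => 1, fun x _ => hasDerivWithinAt_id x I, const 1⟩

theorem add (hf : HolderDeriv α r f) (hg : HolderDeriv α r g) :
    HolderDeriv α r fun x => f x + g x := by
  induction r generalizing f g with
  | zero => exact IsHolder.add hf hg
  | succ r ih =>
    obtain ⟨f', h1, h2⟩ := hf
    obtain ⟨g', k1, k2⟩ := hg
    exact ⟨fun x => f' x + g' x, fun x hx => (h1 x hx).add (k1 x hx), ih h2 k2⟩

theorem mul (hα : 0 < α) (hα1 : α ≤ 1) (hf : HolderDeriv α r f) (hg : HolderDeriv α r g) :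
    HolderDeriv α r fun x => f x * g x := by
  induction r generalizing f g with
  | zero => exact IsHolder.mul hα hf hg
  | succ r ih =>
    have hf0 := hf.pred hα hα1
    have hg0 := hg.pred hα hα1
    obtain ⟨f', h1, h2⟩ := hf
    obtain ⟨g', k1, k2⟩ := hg
    exact ⟨fun x => f' x * g x + f x * g' x, fun x hx => (h1 x hx).mul (k1 x hx),
      (ih h2 hg0).add (ih hf0 k2)⟩

theorem inv {m : ℝ} (hα : 0 < α) (hα1 : α ≤ 1) (hm : 0 < m) (hfm : ∀ x ∈ I, m ≤ f x)
    (hf : HolderDeriv α r f) : HolderDeriv α r fun x => (f x)⁻¹ := by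
  induction r with
  | zero => exact IsHolder.inv hm hfm hf
  | succ r ih =>
    have h0 := ih (hf.pred hα hα1)
    obtain ⟨f', h1, h2⟩ := hf
    refine ⟨fun x => (-1) * f' x * ((f x)⁻¹ * (f x)⁻¹), fun x hx => ?_,
      ((const _).mul hα hα1 h2).mul hα hα1 (h0.mul hα hα1 h0)⟩
    have hx0 : f x ≠ 0 := (hm.trans_le (hfm x hx)).ne'
    refine ((h1 x hx).fun_inv hx0).congr_deriv ?_
    field_simp

/-- The Lipschitz bound on `g` is a separate hypothesis because for `r = 0` the composition of two
`α`-Hölder maps would only have exponent `α ^ 2`. -/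
theorem comp (hα : 0 < α) (hα1 : α ≤ 1) (hf : HolderDeriv α r f) (hg : HolderDeriv α r g)
    (hg1 : IsHolder 1 g) (hI : MapsTo g I I) : HolderDeriv α r fun x => f (g x) := by
  induction r generalizing f with
  | zero => exact IsHolder.comp hα hf hg1 hI
  | succ r ih =>
    have hg0 := hg.pred hα hα1
    obtain ⟨f', h1, h2⟩ := hf
    obtain ⟨g', k1, k2⟩ := hg
    exact ⟨fun x => f' (g x) * g' x, fun x hx => (h1 _ (hI hx)).comp x (k1 x hx) hI,
      (ih h2 hg0).mul hα hα1 k2⟩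

/-- Differentiation lowers the exponent to `α`, where subadditivity of `x ^ α` gives the Hölder
bound. This supplies the singular term of the finitely smooth witness. -/
theorem rpow (hα : 0 < α) (hα1 : α ≤ 1) : HolderDeriv α r fun x => x ^ (r + α) := by
  induction r with
  | zero =>
    refine ⟨1, one_pos, ?_⟩
    have key : ∀ t ∈ I, ∀ u ∈ I, t ≤ u → |u ^ α - t ^ α| ≤ |u - t| ^ α := by
      intro t ht u hu htu
      have := Real.rpow_add_le_add_rpow ht.1 (sub_nonneg.2 htu) hα.le hα1
      rw [abs_of_nonneg (sub_nonneg.2 (Real.rpow_le_rpow ht.1 htu hα.le)),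
        abs_of_nonneg (sub_nonneg.2 htu)]
      rw [add_sub_cancel] at this
      linarith
    intro t ht u hu
    simp only [Nat.cast_zero, zero_add, one_mul]
    rcases le_total t u with h | h
    · exact key t ht u hu h
    · rw [abs_sub_comm, abs_sub_comm u]; exact key u hu t ht h
  | succ r ih =>
    refine ⟨fun x => (r + 1 + α) * x ^ (r + α), fun x hx => ?_, (const _).mul hα hα1 ih⟩
    have := (Real.hasDerivAt_rpow_const (x := x) (p := (r + 1 : ℕ) + α)
      (Or.inr (by push_cast; linarith [r.cast_nonneg (α := ℝ)]))).hasDerivWithinAt (s := I)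
    refine this.congr_deriv ?_
    push_cast
    ring_nf

/-- Links the recursive predicate, for which products, inverses and compositions are short
inductions, to the iterated derivatives used by `IsOfClass`. -/
theorem iff_contDiffOn (hα : 0 < α) :
    HolderDeriv α r f ↔ ContDiffOn ℝ r f I ∧ IsHolder α (iteratedDerivWithin r f I) := by
  induction r generalizing f with
  | zero =>
    rw [iteratedDerivWithin_zero]
    refine ⟨fun h => ⟨?_, h⟩, fun h => h.2⟩
    exact contDiffOn_zero.2 (IsHolder.continuousOn h hα)
  | succ r ih =>
    rw [iteratedDerivWithin_succ']
    push_cast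
    rw [contDiffOn_succ_iff_derivWithin uniqueDiffOn_unitInterval]
    constructor
    · rintro ⟨f', h1, h2⟩
      have h3 : HolderDeriv α r (derivWithin f I) := h2.congr fun x hx =>
        ((h1 x hx).derivWithin (uniqueDiffOn_unitInterval x hx)).symm
      refine ⟨⟨fun x hx => (h1 x hx).differentiableWithinAt, ?_, (ih.1 h3).1⟩, (ih.1 h3).2⟩
      intro h; exact absurd h (by simp)
    · rintro ⟨⟨h1, -, h2⟩, h3⟩
      exact ⟨derivWithin f I, fun x hx => (h1 x hx).hasDerivWithinAt, ih.2 ⟨h2, h3⟩⟩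

theorem of_contDiffOn (hf : ContDiffOn ℝ (r + 1) f I) : HolderDeriv 1 r f := by
  induction r generalizing f with
  | zero =>
    have h1 : ContDiffOn ℝ 1 f I := by simpa using hf
    obtain ⟨C, -, hC⟩ := exists_abs_le_of_continuousOn
      (h1.continuousOn_derivWithin uniqueDiffOn_unitInterval le_rfl)
    exact isHolder_one_of_hasDerivWithinAt
      (fun x hx => (h1.differentiableOn one_ne_zero x hx).hasDerivWithinAt) hC
  | succ r ih =>
    obtain ⟨h1, -, h2⟩ := (contDiffOn_succ_iff_derivWithin uniqueDiffOn_unitInterval).1 hf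
    refine ⟨derivWithin f I, fun x hx => (h1 x hx).hasDerivWithinAt, ih ?_⟩
    exact_mod_cast h2

theorem forall_iff_contDiffOn : (∀ r, HolderDeriv 1 r f) ↔ ContDiffOn ℝ ∞ f I := by
  rw [contDiffOn_infty]
  refine ⟨fun h r => ((iff_contDiffOn one_pos).1 (h r)).1, fun h r => of_contDiffOn ?_⟩
  exact_mod_cast h (r + 1)

end HolderDeriv

/-! ### Regularity classes -/

theorem isOfClass_finite_iff {s : ℝ} (hs : 1 < s) {f : ℝ → ℝ} :
    IsOfClass (.finite s) f ↔ ∃ (r : ℕ) (α : ℝ), 1 ≤ r ∧ 0 < α ∧ α ≤ 1 ∧ s = r + α ∧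
      HolderDeriv α r f := by
  constructor
  · rintro (⟨h, -⟩ | ⟨r, α, h1, h2, h3, h4, h5⟩)
    · exact absurd h hs.ne'
    · exact ⟨r, α, h1, h2, h3, h4, (HolderDeriv.iff_contDiffOn h2).2 h5⟩
  · rintro ⟨r, α, h1, h2, h3, h4, h5⟩
    exact Or.inr ⟨r, α, h1, h2, h3, h4, (HolderDeriv.iff_contDiffOn h2).1 h5⟩

theorem exists_nat_add_eq {s : ℝ} (hs : 1 < s) :
    ∃ (r : ℕ) (α : ℝ), 1 ≤ r ∧ 0 < α ∧ α ≤ 1 ∧ s = r + α := by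
  have h1 : (1 : ℝ) < ⌈s⌉₊ := hs.trans_le (Nat.le_ceil s)
  have h2 : 1 < ⌈s⌉₊ := by exact_mod_cast h1
  have h3 := Nat.le_ceil s
  have h4 := Nat.ceil_lt_add_one (zero_le_one.trans hs.le)
  refine ⟨⌈s⌉₊ - 1, s - (⌈s⌉₊ - 1 : ℕ), by omega, ?_, ?_, by ring⟩ <;>
    (rw [Nat.cast_sub h2.le]; push_cast; linarith)

theorem IsOfClass.finite_one {S : Regularity} {f : ℝ → ℝ} (hS : ∀ s, S = .finite s → 1 ≤ s)
    (hf : IsOfClass S f) : IsOfClass (.finite 1) f := by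
  refine Or.inl ⟨rfl, ?_⟩
  match S, hf with
  | .finite s, Or.inl h => exact h.2
  | .finite s, Or.inr ⟨r, α, h1, _, _, _, h5, _⟩ => exact h5.of_le (by exact_mod_cast h1)
  | .smooth, h => exact ContDiffOn.of_le h (by simp)
  | .analytic, h => exact AnalyticOn.contDiffOn h uniqueDiffOn_unitInterval

theorem IsOfClass.finite_mono {s t : ℝ} (hs : 1 < s) (hst : s ≤ t) {f : ℝ → ℝ}
    (hf : IsOfClass (.finite t) f) : IsOfClass (.finite s) f := by
  obtain ⟨r, α, h1, h2, h3, h4, h5⟩ := (isOfClass_finite_iff (hs.trans_le hst)).1 hf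
  obtain ⟨q, β, k1, k2, k3, k4⟩ := exists_nat_add_eq hs
  exact (isOfClass_finite_iff hs).2 ⟨q, β, k1, k2, k3, k4, h5.mono h2 h3 k2 k3 (by linarith)⟩

theorem IsOfClass.finite_of_smooth {s : ℝ} (hs : 1 < s) {f : ℝ → ℝ}
    (hf : IsOfClass .smooth f) : IsOfClass (.finite s) f := by
  obtain ⟨q, β, k1, k2, k3, k4⟩ := exists_nat_add_eq hs
  exact (isOfClass_finite_iff hs).2
    ⟨q, β, k1, k2, k3, k4, (HolderDeriv.forall_iff_contDiffOn.2 hf q).mono_exponent k2 k3⟩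

theorem IsOfClass.smooth_of_analytic {f : ℝ → ℝ} (hf : IsOfClass .analytic f) :
    IsOfClass .smooth f :=
  AnalyticOn.contDiffOn hf uniqueDiffOn_unitInterval

/-! ### The self-similar Cantor set -/

section SelfSimilar

variable {lam : ℝ} {X : Set ℝ}

theorem selfSimilarIFS_zero (lam x : ℝ) : selfSimilarIFS lam 0 x = lam * x := rfl

theorem selfSimilarIFS_one (lam x : ℝ) : selfSimilarIFS lam 1 x = lam * x + (1 - lam) := rfl

theorem exists_selfSimilarIFS_eq (lam : ℝ) (i : Fin 2) :
    ∃ c, (c = 0 ∨ c = 1 - lam) ∧ ∀ x, selfSimilarIFS lam i x = lam * x + c := by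
  fin_cases i
  · exact ⟨0, Or.inl rfl, fun x => by simp [selfSimilarIFS]⟩
  · exact ⟨1 - lam, Or.inr rfl, fun x => rfl⟩

theorem mapsTo_selfSimilarIFS (h0 : 0 < lam) (h1 : lam < 1 / 2) (i : Fin 2) :
    MapsTo (selfSimilarIFS lam i) I I := by
  obtain ⟨c, hc, h⟩ := exists_selfSimilarIFS_eq lam i
  intro x hx
  rw [h]
  have hx1 : lam * x ≤ lam := mul_le_of_le_one_right h0.le hx.2
  have hx0 : 0 ≤ lam * x := mul_nonneg h0.le hx.1
  rcases hc with rfl | rfl <;> constructor <;> linarith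

theorem IsAttractor.mul_mem (hX : IsAttractor (selfSimilarIFS lam) X) {x : ℝ} (hx : x ∈ X) :
    lam * x ∈ X := by
  rw [hX.invariant]
  exact Or.inl ⟨x, hx, rfl⟩

theorem IsAttractor.mul_add_mem (hX : IsAttractor (selfSimilarIFS lam) X) {x : ℝ} (hx : x ∈ X) :
    lam * x + (1 - lam) ∈ X := by
  rw [hX.invariant]
  exact Or.inr ⟨x, hx, rfl⟩

theorem IsAttractor.mem_cases (hX : IsAttractor (selfSimilarIFS lam) X) {x : ℝ} (hx : x ∈ X) :
    (∃ y ∈ X, lam * y = x) ∨ ∃ y ∈ X, lam * y + (1 - lam) = x := by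
  rw [hX.invariant] at hx
  exact hx

/-- The minimum `m` of `X` satisfies `m ≤ lam * m`, since `lam * m` is again in `X`. -/
theorem IsAttractor.zero_mem (hX : IsAttractor (selfSimilarIFS lam) X)
    (h1 : lam < 1 / 2) : (0 : ℝ) ∈ X := by
  obtain ⟨m, hm, hmin⟩ := hX.isCompact.exists_isLeast hX.nonempty
  have h2 := hmin (hX.mul_mem hm)
  have h3 := (hX.subset hm).1
  have : m = 0 := by nlinarith
  exact this ▸ hm

theorem IsAttractor.one_mem (hX : IsAttractor (selfSimilarIFS lam) X)
    (h1 : lam < 1 / 2) : (1 : ℝ) ∈ X := by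
  obtain ⟨m, hm, hmax⟩ := hX.isCompact.exists_isGreatest hX.nonempty
  have h2 := hmax (hX.mul_add_mem hm)
  have h3 := (hX.subset hm).2
  have : m = 1 := by nlinarith
  exact this ▸ hm

theorem IsAttractor.pow_mul_mem (hX : IsAttractor (selfSimilarIFS lam) X) {x : ℝ} (hx : x ∈ X)
    (n : ℕ) : lam ^ n * x ∈ X := by
  induction n with
  | zero => simpa using hx
  | succ n ih => rw [pow_succ', mul_assoc]; exact hX.mul_mem ih

theorem IsAttractor.one_sub_mem (hX : IsAttractor (selfSimilarIFS lam) X)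
    (h1 : lam < 1 / 2) : 1 - lam ∈ X := by
  simpa using hX.mul_add_mem (hX.zero_mem h1)

theorem IsAttractor.mem_of_le (hX : IsAttractor (selfSimilarIFS lam) X) (h0 : 0 < lam)
    {x : ℝ} (hx : x ∈ X) (hxl : x < 1 - lam) :
    ∃ y ∈ X, lam * y = x := by
  rcases hX.mem_cases hx with h | ⟨y, hy, rfl⟩
  · exact h
  · have := mul_nonneg h0.le (hX.subset hy).1
    linarith

theorem IsAttractor.mem_of_ge (hX : IsAttractor (selfSimilarIFS lam) X) (h0 : 0 < lam)
    {x : ℝ} (hx : x ∈ X) (hxl : lam < x) :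
    ∃ y ∈ X, lam * y + (1 - lam) = x := by
  rcases hX.mem_cases hx with ⟨y, hy, rfl⟩ | h
  · have := mul_le_of_le_one_right h0.le (hX.subset hy).2
    linarith
  · exact h

theorem wordMap_append (f : Fin 2 → ℝ → ℝ) (v w : List (Fin 2)) (x : ℝ) :
    wordMap f (v ++ w) x = wordMap f v (wordMap f w x) := by
  induction v with
  | nil => rfl
  | cons i v ih => simp [wordMap, ih]

theorem wordMap_selfSimilarIFS (lam : ℝ) (w : List (Fin 2)) (x : ℝ) :
    wordMap (selfSimilarIFS lam) w x = wordMap (selfSimilarIFS lam) w 0 + lam ^ w.length * x := by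
  induction w with
  | nil => simp [wordMap]
  | cons i w ih =>
    obtain ⟨c, -, h⟩ := exists_selfSimilarIFS_eq lam i
    simp only [wordMap, Function.comp_apply, h, List.length_cons]
    rw [ih]
    ring

theorem mapsTo_wordMap (h0 : 0 < lam) (h1 : lam < 1 / 2) (w : List (Fin 2)) :
    MapsTo (wordMap (selfSimilarIFS lam) w) I I := by
  induction w with
  | nil => exact mapsTo_id _
  | cons i w ih => exact (mapsTo_selfSimilarIFS h0 h1 i).comp ih

end SelfSimilar

/-! ### Conjugating the self-similar system by a diffeomorphism -/

/-- `h` is an orientation preserving `C¹` diffeomorphism of `[0,1]` with derivative `h'`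
pinched between `a` and `3a/2`, and with inverse `k`. -/
structure IsUnitDiffeo (h h' k : ℝ → ℝ) (a : ℝ) : Prop where
  pos : 0 < a
  hasDeriv : ∀ x ∈ I, HasDerivWithinAt h (h' x) I x
  continuousOn_deriv : ContinuousOn h' I
  le_deriv : ∀ x ∈ I, a ≤ h' x
  deriv_le : ∀ x ∈ I, h' x ≤ 3 / 2 * a
  zero : h 0 = 0
  one : h 1 = 1
  mapsTo_inv : MapsTo k I I
  invOn : InvOn k h I I

theorem zero_mem_I : (0 : ℝ) ∈ I := by simp

theorem one_mem_I : (1 : ℝ) ∈ I := by simp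

theorem exists_slope_eq {h h' : ℝ → ℝ} (hd : ∀ x ∈ I, HasDerivWithinAt h (h' x) I x) {u v : ℝ}
    (hu : 0 ≤ u) (huv : u < v) (hv : v ≤ 1) : ∃ c ∈ Ioo u v, h v - h u = h' c * (v - u) := by
  have hsub : Icc u v ⊆ I := Icc_subset_Icc hu hv
  obtain ⟨c, hc, h1⟩ := exists_hasDerivAt_eq_slope h h' huv
    (fun x hx => ((hd x (hsub hx)).continuousWithinAt).mono hsub)
    (fun x hx => (hd x (hsub (Ioo_subset_Icc_self hx))).hasDerivAt
      (Icc_mem_nhds (hu.trans_lt hx.1) (hx.2.trans_le hv)))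
  refine ⟨c, hc, ?_⟩
  rw [h1, div_mul_cancel₀ _ (sub_pos.2 huv).ne']

theorem strictMonoOn_of_hasDerivWithinAt_pos {h h' : ℝ → ℝ}
    (hd : ∀ x ∈ I, HasDerivWithinAt h (h' x) I x) (hpos : ∀ x ∈ I, 0 < h' x) :
    StrictMonoOn h I := by
  intro u hu v hv huv
  obtain ⟨c, hc, h1⟩ := exists_slope_eq hd hu.1 huv hv.2
  have := mul_pos (hpos c ⟨hu.1.trans hc.1.le, hc.2.le.trans hv.2⟩) (sub_pos.2 huv)
  linarith

theorem exists_isUnitDiffeo {h h' : ℝ → ℝ} {a : ℝ} (pos : 0 < a)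
    (hd : ∀ x ∈ I, HasDerivWithinAt h (h' x) I x) (hc : ContinuousOn h' I)
    (h1 : ∀ x ∈ I, a ≤ h' x) (h2 : ∀ x ∈ I, h' x ≤ 3 / 2 * a) (zero : h 0 = 0) (one : h 1 = 1) :
    ∃ k, IsUnitDiffeo h h' k a := by
  have hmono := strictMonoOn_of_hasDerivWithinAt_pos hd fun x hx => pos.trans_le (h1 x hx)
  have hmaps : MapsTo h I I := fun x hx => by
    refine ⟨?_, ?_⟩
    · rw [← zero]; exact hmono.monotoneOn zero_mem_I hx hx.1
    · rw [← one]; exact hmono.monotoneOn hx one_mem_I hx.2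
  have hsurj : SurjOn h I I := by
    have := intermediate_value_Icc (zero_le_one' ℝ) (f := h)
      fun x hx => (hd x hx).continuousWithinAt
    rwa [zero, one] at this
  exact ⟨Function.invFunOn h I, pos, hd, hc, h1, h2, zero, one, hsurj.mapsTo_invFunOn,
    hmono.injOn.leftInvOn_invFunOn, hsurj.rightInvOn_invFunOn⟩

namespace IsUnitDiffeo

variable {h h' k : ℝ → ℝ} {a lam : ℝ} {X : Set ℝ}

theorem deriv_pos (H : IsUnitDiffeo h h' k a) {x : ℝ} (hx : x ∈ I) : 0 < h' x :=
  H.pos.trans_le (H.le_deriv x hx)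

theorem strictMonoOn (H : IsUnitDiffeo h h' k a) : StrictMonoOn h I :=
  strictMonoOn_of_hasDerivWithinAt_pos H.hasDeriv fun _ => H.deriv_pos

theorem mapsTo (H : IsUnitDiffeo h h' k a) : MapsTo h I I := fun x hx => by
  refine ⟨?_, ?_⟩
  · rw [← H.zero]; exact H.strictMonoOn.monotoneOn zero_mem_I hx hx.1
  · rw [← H.one]; exact H.strictMonoOn.monotoneOn hx one_mem_I hx.2

theorem inv_apply (H : IsUnitDiffeo h h' k a) {x : ℝ} (hx : x ∈ I) : k (h x) = x :=
  H.invOn.1 hx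

theorem apply_inv (H : IsUnitDiffeo h h' k a) {x : ℝ} (hx : x ∈ I) : h (k x) = x :=
  H.invOn.2 hx

theorem inv_zero (H : IsUnitDiffeo h h' k a) : k 0 = 0 := by
  simpa [H.zero] using H.inv_apply zero_mem_I

theorem inv_one (H : IsUnitDiffeo h h' k a) : k 1 = 1 := by
  simpa [H.one] using H.inv_apply one_mem_I

theorem strictMonoOn_inv (H : IsUnitDiffeo h h' k a) : StrictMonoOn k I := fun u hu v hv huv => by
  refine (H.strictMonoOn.lt_iff_lt (H.mapsTo_inv hu) (H.mapsTo_inv hv)).1 ?_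
  rwa [H.apply_inv hu, H.apply_inv hv]

theorem isHolder_inv (H : IsUnitDiffeo h h' k a) : IsHolder 1 k := by
  have key : ∀ t ∈ I, ∀ u ∈ I, t ≤ u → |k u - k t| ≤ a⁻¹ * |u - t| := by
    intro t ht u hu htu
    rcases htu.eq_or_lt with rfl | htu
    · simp
    have hk := H.strictMonoOn_inv ht hu htu
    obtain ⟨c, hc, h1⟩ := exists_slope_eq H.hasDeriv (H.mapsTo_inv ht).1 hk (H.mapsTo_inv hu).2
    rw [H.apply_inv ht, H.apply_inv hu] at h1
    have h2 := H.le_deriv c ⟨(H.mapsTo_inv ht).1.trans hc.1.le, hc.2.le.trans (H.mapsTo_inv hu).2⟩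
    rw [abs_of_pos (sub_pos.2 hk), abs_of_pos (sub_pos.2 htu), h1, ← div_eq_inv_mul,
      le_div_iff₀ H.pos, mul_comm]
    exact mul_le_mul_of_nonneg_right h2 (sub_pos.2 hk).le
  refine .of_bound (C := a⁻¹) fun t ht u hu => ?_
  rw [Real.rpow_one]
  rcases le_total t u with h | h
  · exact key t ht u hu h
  · rw [abs_sub_comm, abs_sub_comm u]; exact key u hu t ht h

theorem hasDeriv_inv (H : IsUnitDiffeo h h' k a) {y : ℝ} (hy : y ∈ I) :
    HasDerivWithinAt k (h' (k y))⁻¹ I y := by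
  have hne : h' (k y) ≠ 0 := (H.deriv_pos (H.mapsTo_inv hy)).ne'
  have hcont : Tendsto k (𝓝[I] y) (𝓝[I] (k y)) :=
    tendsto_nhdsWithin_iff.2 ⟨H.isHolder_inv.continuousOn one_pos y hy,
      eventually_mem_nhdsWithin.mono fun x hx => H.mapsTo_inv hx⟩
  have := HasFDerivWithinAt.of_local_left_inverse (f := h) (g := k) (a := y) (s := I) (t := I)
    (f' := ContinuousLinearEquiv.unitsEquivAut ℝ (Units.mk0 (h' (k y)) hne)) hcont
    (H.hasDeriv _ (H.mapsTo_inv hy)).hasFDerivWithinAt hy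
    (eventually_mem_nhdsWithin.mono fun x hx => H.apply_inv hx)
  simpa using this.hasDerivWithinAt

theorem holderDeriv_deriv (H : IsUnitDiffeo h h' k a) {α : ℝ} {r : ℕ}
    (hh : HolderDeriv α (r + 1) h) : HolderDeriv α r h' := by
  obtain ⟨f', h1, h2⟩ := hh
  exact h2.congr fun x hx => (uniqueDiffOn_unitInterval x hx).eq_deriv _ (h1 x hx) (H.hasDeriv x hx)

/-- Bootstrap on `k' = 1 / (h' ∘ k)`: regularity of `k` at order `r` gives that of `k'` at order
`r`. -/
theorem holderDeriv_inv (H : IsUnitDiffeo h h' k a) {α : ℝ} {r : ℕ} (hα : 0 < α) (hα1 : α ≤ 1)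
    (hh : HolderDeriv α r h) : HolderDeriv α r k := by
  induction r with
  | zero => exact H.isHolder_inv.mono hα hα1
  | succ r ih =>
    exact ⟨fun y => (h' (k y))⁻¹, fun y hy => H.hasDeriv_inv hy,
      ((H.holderDeriv_deriv hh).comp hα hα1 (ih (hh.pred hα hα1)) H.isHolder_inv
        H.mapsTo_inv).inv hα hα1 H.pos fun x hx => H.le_deriv _ (H.mapsTo_inv hx)⟩

end IsUnitDiffeo

/-- The conjugate by `h` (with inverse `k`) of the self-similar system. -/
noncomputable def conjIFS (lam : ℝ) (h k : ℝ → ℝ) (i : Fin 2) (x : ℝ) : ℝ :=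
  h (selfSimilarIFS lam i (k x))

namespace IsUnitDiffeo

variable {h h' k : ℝ → ℝ} {a lam : ℝ} {X : Set ℝ}

theorem holderDeriv_conjIFS (H : IsUnitDiffeo h h' k a) (h0 : 0 < lam) (h1 : lam < 1 / 2) {α : ℝ}
    {r : ℕ} (hα : 0 < α) (hα1 : α ≤ 1) (hh : HolderDeriv α r h) (i : Fin 2) :
    HolderDeriv α r (conjIFS lam h k i) := by
  obtain ⟨c, -, hc⟩ := exists_selfSimilarIFS_eq lam i
  have hg : ∀ {β : ℝ} {q : ℕ}, 0 < β → β ≤ 1 → HolderDeriv β q (selfSimilarIFS lam i) :=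
    fun hβ hβ1 => (((HolderDeriv.const lam).mul hβ hβ1 (.id hβ hβ1)).add (.const c)).congr
      fun x _ => (hc x).symm
  have hgk : HolderDeriv α r fun x => selfSimilarIFS lam i (k x) :=
    (hg hα hα1).comp hα hα1 (H.holderDeriv_inv hα hα1 hh) H.isHolder_inv H.mapsTo_inv
  have hgk1 : IsHolder 1 fun x => selfSimilarIFS lam i (k x) :=
    IsHolder.comp one_pos (hg (q := 0) one_pos le_rfl) H.isHolder_inv H.mapsTo_inv
  exact HolderDeriv.comp (f := h) hα hα1 hh hgk hgk1
    ((mapsTo_selfSimilarIFS h0 h1 i).comp H.mapsTo_inv)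

theorem isHyperbolicIFS_conjIFS (H : IsUnitDiffeo h h' k a) (h0 : 0 < lam) (h1 : lam < 1 / 2)
    {S : Regularity} (hS : ∀ i, IsOfClass S (conjIFS lam h k i)) :
    IsHyperbolicIFS S (conjIFS lam h k) where
  isOfClass := hS
  deriv_bounds i := by
    obtain ⟨c, -, hc⟩ := exists_selfSimilarIFS_eq lam i
    -- The derivative of the conjugate is `lam` times a quotient of two values of `h'`. The pinching
    -- keeps this quotient in `[2/3, 3/2]`, and `lam < 1/2` gives an upper bound below `3/4`.
    refine ⟨2 / 3 * lam, 3 / 2 * lam, by positivity, by linarith, fun t ht => ?_⟩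
    have hk := H.mapsTo_inv ht
    have hgk := mapsTo_selfSimilarIFS h0 h1 i hk
    have hg : HasDerivWithinAt (selfSimilarIFS lam i) lam I (k t) := by
      have : HasDerivWithinAt (fun x => lam * x + c) lam I (k t) := by
        simpa using ((hasDerivWithinAt_id (k t) I).const_mul lam).add_const c
      exact this.congr (fun x _ => hc x) (hc _)
    have hd : HasDerivWithinAt (conjIFS lam h k i)
        (h' (selfSimilarIFS lam i (k t)) * (lam * (h' (k t))⁻¹)) I t :=
      (H.hasDeriv _ hgk).comp t (hg.comp t (H.hasDeriv_inv ht) H.mapsTo_inv)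
        ((mapsTo_selfSimilarIFS h0 h1 i).comp H.mapsTo_inv)
    rw [hd.derivWithin (uniqueDiffOn_unitInterval t ht)]
    have p1 := H.deriv_pos hk
    have p2 := H.deriv_pos hgk
    have l1 := H.le_deriv _ hk
    have l2 := H.le_deriv _ hgk
    have u1 := H.deriv_le _ hk
    have u2 := H.deriv_le _ hgk
    rw [abs_of_pos (by positivity), ← mul_assoc, ← div_eq_mul_inv, le_div_iff₀ p1, div_le_iff₀ p1]
    constructor <;> nlinarith
  zero_zero := by simp [conjIFS, selfSimilarIFS_zero, H.inv_zero, H.zero]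
  zero_one_pos := by
    have : conjIFS lam h k 0 1 = h lam := by simp [conjIFS, selfSimilarIFS_zero, H.inv_one]
    rw [this]
    conv_lhs => rw [← H.zero]
    exact H.strictMonoOn zero_mem_I ⟨h0.le, by linarith⟩ h0
  separated := by
    have e0 : conjIFS lam h k 0 1 = h lam := by simp [conjIFS, selfSimilarIFS_zero, H.inv_one]
    have e1 : conjIFS lam h k 1 0 = h (1 - lam) := by
      simp [conjIFS, selfSimilarIFS_one, H.inv_zero]
    rw [e0, e1]
    exact H.strictMonoOn ⟨h0.le, by linarith⟩ ⟨by linarith, by linarith⟩ (by linarith)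
  one_zero_lt := by
    have e0 : conjIFS lam h k 1 1 = h 1 := by simp [conjIFS, selfSimilarIFS_one, H.inv_one]
    have e1 : conjIFS lam h k 1 0 = h (1 - lam) := by
      simp [conjIFS, selfSimilarIFS_one, H.inv_zero]
    rw [e0, e1]
    exact H.strictMonoOn ⟨by linarith, by linarith⟩ one_mem_I (by linarith)
  one_one := by simp [conjIFS, selfSimilarIFS_one, H.inv_one, H.one]

theorem isAttractor_conjIFS (H : IsUnitDiffeo h h' k a)
    (hX : IsAttractor (selfSimilarIFS lam) X) : IsAttractor (conjIFS lam h k) (h '' X) where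
  subset := by rintro _ ⟨x, hx, rfl⟩; exact H.mapsTo (hX.subset hx)
  nonempty := hX.nonempty.image h
  isCompact := hX.isCompact.image_of_continuousOn
    fun x hx => (H.hasDeriv x (hX.subset hx)).continuousWithinAt.mono hX.subset
  invariant := by
    have e : ∀ i, conjIFS lam h k i '' (h '' X) = h '' (selfSimilarIFS lam i '' X) := by
      intro i
      rw [image_image, image_image]
      exact image_congr fun x hx => by rw [conjIFS, H.inv_apply (hX.subset hx)]
    rw [e, e, ← image_union, ← hX.invariant]

/-! ### Cylinder lengths and the scaling function of the conjugate system. -/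

theorem wordMap_conjIFS (H : IsUnitDiffeo h h' k a) (h0 : 0 < lam) (h1 : lam < 1 / 2)
    (w : List (Fin 2)) {x : ℝ} (hx : x ∈ I) :
    wordMap (conjIFS lam h k) w (h x) = h (wordMap (selfSimilarIFS lam) w x) := by
  induction w with
  | nil => rfl
  | cons i w ih =>
    simp only [wordMap, Function.comp_apply, ih]
    rw [conjIFS, H.inv_apply (mapsTo_wordMap h0 h1 w hx)]

theorem _root_.Metric.diam_eq_sub_of_mem {S : Set ℝ} {p q : ℝ} (hp : p ∈ S) (hq : q ∈ S)
    (hpq : p ≤ q) (hS : S ⊆ Icc p q) : Metric.diam S = q - p := by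
  apply le_antisymm
  · refine Metric.diam_le_of_forall_dist_le (sub_nonneg.2 hpq) fun x hx y hy => ?_
    exact Real.dist_le_of_mem_Icc (hS hx) (hS hy)
  · have := Metric.dist_le_diam_of_mem ((Metric.isBounded_Icc p q).subset hS) hq hp
    rwa [Real.dist_eq, abs_of_nonneg (sub_nonneg.2 hpq)] at this

theorem diam_cylinder (H : IsUnitDiffeo h h' k a) (h0 : 0 < lam) (h1 : lam < 1 / 2)
    (hX : IsAttractor (selfSimilarIFS lam) X) (w : List (Fin 2)) :
    Metric.diam (cylinder (conjIFS lam h k) (h '' X) w) =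
      h (wordMap (selfSimilarIFS lam) w 1) - h (wordMap (selfSimilarIFS lam) w 0) := by
  have e : cylinder (conjIFS lam h k) (h '' X) w =
      (fun x => h (wordMap (selfSimilarIFS lam) w x)) '' X := by
    rw [cylinder, image_image]
    exact image_congr fun x hx => H.wordMap_conjIFS h0 h1 w (hX.subset hx)
  have hm : MonotoneOn (fun x => h (wordMap (selfSimilarIFS lam) w x)) I := by
    intro x hx y hy hxy
    refine H.strictMonoOn.monotoneOn (mapsTo_wordMap h0 h1 w hx) (mapsTo_wordMap h0 h1 w hy) ?_
    rw [wordMap_selfSimilarIFS lam w x, wordMap_selfSimilarIFS lam w y]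
    gcongr
  rw [e]
  refine Metric.diam_eq_sub_of_mem ⟨0, hX.zero_mem h1, rfl⟩ ⟨1, hX.one_mem h1, rfl⟩
    (hm zero_mem_I one_mem_I zero_le_one) ?_
  rintro _ ⟨x, hx, rfl⟩
  have hxI := hX.subset hx
  exact ⟨hm zero_mem_I hxI hxI.1, hm hxI one_mem_I hxI.2⟩

/-- By the mean value theorem `h` multiplies the ratio of lengths by a quotient of two values of
`h'` taken inside `[u, v]`; uniform continuity of `h'` makes this quotient close to 1. -/
theorem exists_ratio_close (H : IsUnitDiffeo h h' k a) {ε : ℝ} (hε : 0 < ε) :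
    ∃ δ > 0, ∀ u v u' v' : ℝ, 0 ≤ u → u ≤ u' → u' < v' → v' ≤ v → v ≤ 1 → v - u < δ →
      |(h v' - h u') / (h v - h u) - (v' - u') / (v - u)| < ε := by
  have huc := isCompact_Icc.uniformContinuousOn_of_continuous H.continuousOn_deriv
  obtain ⟨δ, hδ, hδ'⟩ := Metric.uniformContinuousOn_iff.1 huc (ε * a) (mul_pos hε H.pos)
  refine ⟨δ, hδ, fun u v u' v' hu huu huv hvv hv hd => ?_⟩
  obtain ⟨c, hc, e1⟩ := exists_slope_eq H.hasDeriv (hu.trans huu) huv (hvv.trans hv)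
  obtain ⟨d, hd', e2⟩ := exists_slope_eq H.hasDeriv hu (huu.trans_lt (huv.trans_le hvv)) hv
  have hcI : c ∈ I := ⟨by linarith [hc.1], by linarith [hc.2]⟩
  have hdI : d ∈ I := ⟨by linarith [hd'.1], by linarith [hd'.2]⟩
  have hdist := hδ' c hcI d hdI (by
    rw [Real.dist_eq, abs_lt]; constructor <;> linarith [hc.1, hc.2, hd'.1, hd'.2])
  rw [Real.dist_eq] at hdist
  have hp := H.deriv_pos hdI
  have hvu : 0 < v - u := by linarith
  have hq : 0 ≤ (v' - u') / (v - u) := div_nonneg (by linarith) hvu.le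
  have hq1 : (v' - u') / (v - u) ≤ 1 := (div_le_one hvu).2 (by linarith)
  rw [e1, e2, mul_div_mul_comm]
  calc |h' c / h' d * ((v' - u') / (v - u)) - (v' - u') / (v - u)|
      = |(h' c - h' d) / h' d * ((v' - u') / (v - u))| := by
        congr 1; field_simp
    _ = |h' c - h' d| / h' d * ((v' - u') / (v - u)) := by
        rw [abs_mul, abs_div, abs_of_pos hp, abs_of_nonneg hq]
    _ ≤ |h' c - h' d| / h' d * 1 := by gcongr
    _ < ε := by
        rw [mul_one, div_lt_iff₀ hp]
        exact hdist.trans_le (mul_le_mul_of_nonneg_left (H.le_deriv d hdI) hε.le)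

theorem hasScalingFunction_conjIFS (H : IsUnitDiffeo h h' k a) (h0 : 0 < lam) (h1 : lam < 1 / 2)
    (hX : IsAttractor (selfSimilarIFS lam) X) :
    HasScalingFunction (conjIFS lam h k) (h '' X) fun _ => (lam, 1 - 2 * lam, lam) := by
  intro y
  have hpow : Tendsto (fun n : ℕ => lam ^ n) atTop (𝓝 0) :=
    tendsto_pow_atTop_nhds_zero_of_lt_one h0.le (by linarith)
  have key : ∀ i : Fin 2, Tendsto (fun n : ℕ =>
      Metric.diam (cylinder (conjIFS lam h k) (h '' X) (dualWord y n ++ [i])) /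
        Metric.diam (cylinder (conjIFS lam h k) (h '' X) (dualWord y n))) atTop (𝓝 lam) := by
    intro i
    rw [Metric.tendsto_atTop]
    intro ε hε
    obtain ⟨δ, hδ, hclose⟩ := H.exists_ratio_close hε
    obtain ⟨N, hN⟩ := (hpow.eventually_lt_const hδ).exists_forall_of_atTop
    refine ⟨N, fun n hn => ?_⟩
    have hlen : (dualWord y n).length = n := by simp [dualWord]
    rw [Real.dist_eq, H.diam_cylinder h0 h1 hX, H.diam_cylinder h0 h1 hX, wordMap_append,
      wordMap_append]
    set W := wordMap (selfSimilarIFS lam) (dualWord y n) with hW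
    have hWI := mapsTo_wordMap h0 h1 (dualWord y n)
    have hWe : ∀ x, W x = W 0 + lam ^ n * x := fun x => by
      rw [hW, wordMap_selfSimilarIFS, hlen]
    obtain ⟨c, hc, hg⟩ := exists_selfSimilarIFS_eq lam i
    have hgi : ∀ x, wordMap (selfSimilarIFS lam) [i] x = lam * x + c := fun x => by
      simp [wordMap, hg]
    have hp : 0 < lam ^ n := pow_pos h0 n
    have hc0 : 0 ≤ c ∧ lam + c ≤ 1 := by rcases hc with rfl | rfl <;> constructor <;> linarith
    have := hclose (W 0) (W 1) (W c) (W (lam + c)) (hWI zero_mem_I).1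
      (by rw [hWe c]; nlinarith [hc0.1]) (by rw [hWe c, hWe (lam + c)]; nlinarith)
      (by rw [hWe 1, hWe (lam + c)]; nlinarith [hc0.2]) (hWI one_mem_I).2
      (by rw [hWe 1]; simpa using hN n hn)
    -- Before conjugation every cylinder is divided in exactly the ratio `lam`; only the distortion
    -- of `h` has to vanish in the limit.
    have e : (W (lam + c) - W c) / (W 1 - W 0) = lam := by
      rw [hWe (lam + c), hWe c, hWe 1]; field_simp; ring
    rw [e] at this
    simpa [hgi] using this
  have k0 := key 0
  have k1 := key 1
  have h2 := (k0.add k1).const_sub 1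
  rw [show 1 - (lam + lam) = 1 - 2 * lam by ring] at h2
  refine k0.prodMk_nhds (Tendsto.prodMk_nhds (h2.congr fun n => ?_) k1)
  rw [add_div]

theorem image_mem_equivClass (H : IsUnitDiffeo h h' k a) (h0 : 0 < lam) (h1 : lam < 1 / 2)
    (hX : IsAttractor (selfSimilarIFS lam) X) {S : Regularity} (hh : IsOfClass S h)
    (hk : IsOfClass S k) (hS : ∀ i, IsOfClass S (conjIFS lam h k i)) :
    h '' X ∈ equivClass lam S X :=
  ⟨⟨conjIFS lam h k, H.isHyperbolicIFS_conjIFS h0 h1 hS, H.isAttractor_conjIFS hX,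
    H.hasScalingFunction_conjIFS h0 h1 hX⟩,
    h, k, hh, hk, H.mapsTo, H.mapsTo_inv, H.invOn, H.strictMonoOn, rfl⟩

end IsUnitDiffeo

/-! ### Gaps of the self-similar Cantor set -/

section Gaps

variable {lam : ℝ} {X : Set ℝ}

/-- Both `lam` and `1 - lam` lie in `X`, so they bound any gap reaching across the middle. -/
theorem IsAttractor.gap_left_right (hX : IsAttractor (selfSimilarIFS lam) X) (h0 : 0 < lam)
    (h1 : lam < 1 / 2) {u v : ℝ} (hu : u ∈ X)
    (hgap : ∀ x ∈ X, ¬(u < x ∧ x < v)) (hu1 : u < 1 - lam) (hv1 : 1 - lam ≤ v) :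
    u = lam ∧ v = 1 - lam := by
  obtain ⟨u', hu', rfl⟩ := hX.mem_of_le h0 hu hu1
  have h2 : lam * u' ≤ lam := mul_le_of_le_one_right h0.le (hX.subset hu').2
  have h3 : lam ∈ X := by simpa using hX.mul_mem (hX.one_mem h1)
  have h4 := hgap _ h3
  have h5 := hgap _ (hX.one_sub_mem h1)
  constructor
  · by_contra hne
    exact h4 ⟨lt_of_le_of_ne h2 hne, by linarith⟩
  · by_contra hne
    exact h5 ⟨hu1, lt_of_le_of_ne hv1 (Ne.symm hne)⟩

/-- A gap inside an outer piece is a copy, contracted by `lam`, of another gap, so the central gap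
is the longest. The exponent `n` with `lam ^ n < v - u` bounds the number of rescalings and carries
the induction. -/
theorem IsAttractor.gap_length_le (hX : IsAttractor (selfSimilarIFS lam) X) (h0 : 0 < lam)
    (h1 : lam < 1 / 2) {u v : ℝ} (hu : u ∈ X) (hv : v ∈ X) (huv : u < v)
    (hgap : ∀ x ∈ X, ¬(u < x ∧ x < v)) : v - u ≤ 1 - 2 * lam := by
  obtain ⟨n, hn⟩ := exists_pow_lt_of_lt_one (sub_pos.2 huv) (by linarith : lam < 1)
  induction n generalizing u v with
  | zero =>
    have := (hX.subset hu).1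
    have := (hX.subset hv).2
    rw [pow_zero] at hn
    linarith
  | succ n ih =>
    rw [pow_succ'] at hn
    rcases lt_or_ge v (1 - lam) with h2 | h2
    · obtain ⟨u', hu', rfl⟩ := hX.mem_of_le h0 hu (huv.trans h2)
      obtain ⟨v', hv', rfl⟩ := hX.mem_of_le h0 hv h2
      rw [← mul_sub] at hn ⊢
      have := ih hu' hv' (lt_of_mul_lt_mul_left huv h0.le)
        (fun x hx hx' => hgap _ (hX.mul_mem hx)
          ⟨mul_lt_mul_of_pos_left hx'.1 h0, mul_lt_mul_of_pos_left hx'.2 h0⟩)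
        (lt_of_mul_lt_mul_left hn h0.le)
      nlinarith
    · rcases lt_or_ge u (1 - lam) with h3 | h3
      · obtain ⟨rfl, rfl⟩ := hX.gap_left_right h0 h1 hu hgap h3 h2
        linarith
      · obtain ⟨u', hu', rfl⟩ := hX.mem_of_ge h0 hu (by linarith)
        obtain ⟨v', hv', rfl⟩ := hX.mem_of_ge h0 hv (by linarith)
        rw [add_sub_add_right_eq_sub, ← mul_sub] at hn ⊢
        have := ih hu' hv' (lt_of_mul_lt_mul_left (by linarith) h0.le)
          (fun x hx hx' => hgap _ (hX.mul_add_mem hx)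
            ⟨by linarith [mul_lt_mul_of_pos_left hx'.1 h0],
              by linarith [mul_lt_mul_of_pos_left hx'.2 h0]⟩)
          (lt_of_mul_lt_mul_left hn h0.le)
        nlinarith

/-- A gap of the self-similar Cantor set either starts at a power of `lam`, or is relatively
short compared with its distance from `0`. -/
theorem IsAttractor.gap_cases (hX : IsAttractor (selfSimilarIFS lam) X) (h0 : 0 < lam)
    (h1 : lam < 1 / 2) {u v : ℝ} (hu : u ∈ X) (hv : v ∈ X) (hu0 : 0 < u) (huv : u < v)
    (hgap : ∀ x ∈ X, ¬(u < x ∧ x < v)) :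
    (∃ m : ℕ, u = lam ^ m) ∨ v - u ≤ lam * (1 - 2 * lam) / (1 - lam) * u := by
  -- The induction is measured by `u` rather than by the gap length, because only gaps in the left
  -- piece are rescaled.
  obtain ⟨n, hn⟩ := exists_pow_lt_of_lt_one hu0 (by linarith : lam < 1)
  induction n generalizing u v with
  | zero =>
    have := (hX.subset hu).2
    rw [pow_zero] at hn
    linarith
  | succ n ih =>
    rw [pow_succ'] at hn
    rcases lt_or_ge v (1 - lam) with h2 | h2
    · obtain ⟨u', hu', rfl⟩ := hX.mem_of_le h0 hu (huv.trans h2)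
      obtain ⟨v', hv', rfl⟩ := hX.mem_of_le h0 hv h2
      rcases ih hu' hv' (pos_of_mul_pos_right hu0 h0.le) (lt_of_mul_lt_mul_left huv h0.le)
        (fun x hx hx' => hgap _ (hX.mul_mem hx)
          ⟨mul_lt_mul_of_pos_left hx'.1 h0, mul_lt_mul_of_pos_left hx'.2 h0⟩)
        (lt_of_mul_lt_mul_left hn h0.le) with ⟨m, rfl⟩ | h
      · exact Or.inl ⟨m + 1, (pow_succ' _ _).symm⟩
      · right
        rw [← mul_sub, mul_left_comm]
        exact mul_le_mul_of_nonneg_left h h0.le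
    · rcases lt_or_ge u (1 - lam) with h3 | h3
      · exact Or.inl ⟨1, by rw [pow_one]; exact (hX.gap_left_right h0 h1 hu hgap h3 h2).1⟩
      · right
        obtain ⟨u', hu', rfl⟩ := hX.mem_of_ge h0 hu (by linarith)
        obtain ⟨v', hv', rfl⟩ := hX.mem_of_ge h0 hv (by linarith)
        -- A gap in the right piece has length at most `lam * (1 - 2 * lam)` and starts at or beyond
        -- `1 - lam`, whence the constant.
        have := hX.gap_length_le h0 h1 hu' hv' (lt_of_mul_lt_mul_left (by linarith) h0.le)
          (fun x hx hx' => hgap _ (hX.mul_add_mem hx)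
            ⟨by linarith [mul_lt_mul_of_pos_left hx'.1 h0],
              by linarith [mul_lt_mul_of_pos_left hx'.2 h0]⟩)
        rw [add_sub_add_right_eq_sub, ← mul_sub]
        have h4 : 0 < 1 - lam := by linarith
        have h5 : 0 ≤ lam * (1 - 2 * lam) := mul_nonneg h0.le (by linarith)
        calc lam * (v' - u') ≤ lam * (1 - 2 * lam) := mul_le_mul_of_nonneg_left this h0.le
          _ = lam * (1 - 2 * lam) / (1 - lam) * (1 - lam) := by field_simp
          _ ≤ _ := mul_le_mul_of_nonneg_left h3 (div_nonneg h5 h4.le)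

end Gaps

/-! ### Hyperbolic systems whose attractor is diffeomorphic to the self-similar Cantor set -/

section Rigidity

variable {f : Fin 2 → ℝ → ℝ} {S : Regularity}

theorem IsOfClass.contDiffOn_one {g : ℝ → ℝ} (hg : IsOfClass (.finite 1) g) :
    ContDiffOn ℝ 1 g I := by
  rcases hg with h | ⟨r, α, h1, h2, -, h4, -⟩
  · exact h.2
  · have : (1 : ℝ) ≤ r := by exact_mod_cast h1
    linarith

theorem IsHyperbolicIFS.hasDerivWithinAt (hf : IsHyperbolicIFS (.finite 1) f) (i : Fin 2) {x : ℝ}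
    (hx : x ∈ I) : HasDerivWithinAt (f i) (derivWithin (f i) I x) I x :=
  ((hf.isOfClass i).contDiffOn_one.differentiableOn one_ne_zero x hx).hasDerivWithinAt

theorem IsHyperbolicIFS.lt_apply_one (hf : IsHyperbolicIFS S f) (i : Fin 2) : f i 0 < f i 1 := by
  match i with
  | 0 => rw [hf.zero_zero]; exact hf.zero_one_pos
  | 1 => exact hf.one_zero_lt

/-- The derivative never vanishes and is continuous, so its sign is constant; the order of the
images of the endpoints makes it positive somewhere. -/
theorem IsHyperbolicIFS.derivWithin_pos (hf : IsHyperbolicIFS (.finite 1) f) (i : Fin 2) {x : ℝ}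
    (hx : x ∈ I) : 0 < derivWithin (f i) I x := by
  obtain ⟨m, M, hm, -, hb⟩ := hf.deriv_bounds i
  obtain ⟨c, hc, h1⟩ := exists_slope_eq (fun x hx => hf.hasDerivWithinAt i hx) le_rfl one_pos le_rfl
  have hcI : c ∈ I := Ioo_subset_Icc_self hc
  have hlt := hf.lt_apply_one i
  have hcpos : 0 < derivWithin (f i) I c := by rw [sub_zero, mul_one] at h1; linarith
  by_contra hneg
  have hcont := (hf.isOfClass i).contDiffOn_one.continuousOn_derivWithin uniqueDiffOn_unitInterval
    le_rfl
  obtain ⟨z, hz, hz0⟩ := (isPreconnected_Icc.intermediate_value hx hcI hcont)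
    ⟨not_lt.1 hneg, hcpos.le⟩
  have := (hb z hz).1
  rw [hz0, abs_zero] at this
  linarith

theorem IsHyperbolicIFS.strictMonoOn (hf : IsHyperbolicIFS (.finite 1) f) (i : Fin 2) :
    StrictMonoOn (f i) I :=
  strictMonoOn_of_hasDerivWithinAt_pos (fun _ hx => hf.hasDerivWithinAt i hx)
    fun _ hx => hf.derivWithin_pos i hx

theorem IsHyperbolicIFS.mapsTo_zero (hf : IsHyperbolicIFS (.finite 1) f) : MapsTo (f 0) I I := by
  intro x hx
  have h1 := (hf.strictMonoOn 0).monotoneOn zero_mem_I hx hx.1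
  have h2 := (hf.strictMonoOn 0).monotoneOn hx one_mem_I hx.2
  rw [hf.zero_zero] at h1
  have h3 := hf.separated
  have h4 := hf.one_zero_lt
  have h5 := hf.one_one
  exact ⟨h1, by linarith⟩

theorem IsHyperbolicIFS.image_zero (hf : IsHyperbolicIFS (.finite 1) f) {Y : Set ℝ}
    (hY : IsAttractor f Y) {y : ℝ} (hy : y ∈ Y) (hy1 : y ≤ f 0 1) : ∃ x ∈ Y, f 0 x = y := by
  rw [hY.invariant] at hy
  rcases hy with h | ⟨x, hx, rfl⟩
  · exact h
  · have hxI := hY.subset hx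
    have h1 := (hf.strictMonoOn 1).monotoneOn zero_mem_I hxI hxI.1
    have := hf.separated
    linarith

theorem tendsto_div_of_hasDerivWithinAt_zero {g : ℝ → ℝ} {m : ℝ}
    (hg : HasDerivWithinAt g m I 0) (hg0 : g 0 = 0) {x : ℕ → ℝ} (hx0 : ∀ n, 0 < x n)
    (hx1 : ∀ n, x n ≤ 1) (hx : Tendsto x atTop (𝓝 0)) :
    Tendsto (fun n => g (x n) / x n) atTop (𝓝 m) := by
  have h := hasDerivWithinAt_iff_tendsto_slope.1 hg
  have hx' : Tendsto x atTop (𝓝[I \ {0}] 0) := tendsto_nhdsWithin_iff.2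
    ⟨hx, Eventually.of_forall fun n => ⟨⟨(hx0 n).le, hx1 n⟩, (hx0 n).ne'⟩⟩
  refine (h.comp hx').congr fun n => ?_
  simp [slope_def_field, hg0]

theorem eventually_eq_intCast_of_tendsto {L : ℕ → ℝ} {l : ℝ} (hL : Tendsto L atTop (𝓝 l))
    (hint : ∀ᶠ n in atTop, ∃ z : ℤ, (z : ℝ) = L n) :
    ∃ K : ℤ, l = K ∧ ∀ᶠ n in atTop, L n = K := by
  obtain ⟨K, hK⟩ := Int.isClosedEmbedding_coe_real.isClosed_range.mem_of_tendsto hL hint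
  refine ⟨K, hK.symm, ?_⟩
  have h1 : ∀ᶠ n in atTop, |L n - l| < 1 := by
    have := Metric.tendsto_nhds.1 hL 1 one_pos
    simpa [Real.dist_eq] using this
  filter_upwards [hint, h1] with n ⟨z, hz⟩ hn
  rw [← hz, ← hK] at hn
  rw [← hz]
  have : |z - K| < 1 := by exact_mod_cast hn
  rw [Int.abs_lt_one_iff] at this
  rw [sub_eq_zero.1 this]

/-- If `h(X)` is the attractor of a hyperbolic system `f`, then near `0` the conjugate of `f 0`
shifts the powers of `lam`. -/
theorem IsUnitDiffeo.exists_shift {h h' k : ℝ → ℝ} {a lam : ℝ} {X : Set ℝ}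
    (H : IsUnitDiffeo h h' k a) (h0 : 0 < lam) (h1 : lam < 1 / 2)
    (hX : IsAttractor (selfSimilarIFS lam) X) (hf : IsHyperbolicIFS (.finite 1) f)
    (hY : IsAttractor f (h '' X)) :
    ∃ K : ℕ, 1 ≤ K ∧ ∀ᶠ n : ℕ in atTop, f 0 (h (lam ^ n)) = h (lam ^ (n + K)) := by
  set μ := derivWithin (f 0) I 0 with hμ
  have hμ0 : 0 < μ := hf.derivWithin_pos 0 zero_mem_I
  have hμ1 : μ < 1 := by
    obtain ⟨m, M, -, hM, hb⟩ := hf.deriv_bounds 0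
    have := (hb 0 zero_mem_I).2
    rw [abs_of_pos hμ0] at this
    linarith
  set g : ℝ → ℝ := fun x => k (f 0 (h x)) with hg
  have hg0 : g 0 = 0 := by simp [hg, H.zero, hf.zero_zero, H.inv_zero]
  have hgI : MapsTo g I I := H.mapsTo_inv.comp (hf.mapsTo_zero.comp H.mapsTo)
  have hgmono : StrictMonoOn g I := fun x hx y hy hxy =>
    H.strictMonoOn_inv (hf.mapsTo_zero (H.mapsTo hx)) (hf.mapsTo_zero (H.mapsTo hy))
      (hf.strictMonoOn 0 (H.mapsTo hx) (H.mapsTo hy) (H.strictMonoOn hx hy hxy))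
  have hhg : ∀ x ∈ I, h (g x) = f 0 (h x) := fun x hx =>
    H.apply_inv (hf.mapsTo_zero (H.mapsTo hx))
  have hgX : ∀ x ∈ X, g x ∈ X := fun x hx => by
    have : f 0 (h x) ∈ h '' X := by
      rw [hY.invariant]; exact Or.inl ⟨h x, ⟨x, hx, rfl⟩, rfl⟩
    obtain ⟨z, hz, hz'⟩ := this
    have : g x = z := by rw [hg]; simp only; rw [← hz', H.inv_apply (hX.subset hz)]
    rwa [this]
  have hgsurj : ∀ x ∈ X, x ≤ g 1 → ∃ z ∈ X, g z = x := fun x hx hx1 => by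
    have hle : h x ≤ f 0 1 := by
      have := H.strictMonoOn.monotoneOn (hX.subset hx) (hgI one_mem_I) hx1
      rwa [hhg 1 one_mem_I, H.one] at this
    obtain ⟨_, ⟨z, hz, rfl⟩, hzx⟩ := hf.image_zero hY ⟨x, hx, rfl⟩ hle
    exact ⟨z, hz, by rw [hg]; simp only; rw [hzx, H.inv_apply (hX.subset hx)]⟩
  -- All maps fix 0, so the factors `h' 0` and `(h' 0)⁻¹` cancel and conjugation keeps the
  -- multiplier `μ`.
  have hgd : HasDerivWithinAt g μ I 0 := by
    have d1 := H.hasDeriv 0 zero_mem_I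
    have d2 : HasDerivWithinAt (f 0) μ I (h 0) := by
      rw [H.zero]; exact hf.hasDerivWithinAt 0 zero_mem_I
    have d3 : HasDerivWithinAt k (h' 0)⁻¹ I (f 0 (h 0)) := by
      have := H.hasDeriv_inv zero_mem_I
      rw [H.inv_zero] at this
      rwa [H.zero, hf.zero_zero]
    have := d3.comp 0 (d2.comp 0 d1 H.mapsTo) (hf.mapsTo_zero.comp H.mapsTo)
    refine this.congr_deriv ?_
    have := H.deriv_pos zero_mem_I
    field_simp
  have hlam1 : lam < 1 := by linarith
  have hpow : Tendsto (fun n : ℕ => lam ^ n) atTop (𝓝 0) :=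
    tendsto_pow_atTop_nhds_zero_of_lt_one h0.le hlam1
  have hpos : ∀ n : ℕ, 0 < lam ^ n := fun n => pow_pos h0 n
  have hle : ∀ n : ℕ, lam ^ n ≤ 1 := fun n => pow_le_one₀ h0.le hlam1.le
  have t1 : Tendsto (fun n => g (lam ^ n) / lam ^ n) atTop (𝓝 μ) :=
    tendsto_div_of_hasDerivWithinAt_zero hgd hg0 hpos hle hpow
  have t1' := t1.comp (tendsto_add_atTop_nat 1)
  have t2 : Tendsto (fun n => g (lam ^ n * (1 - lam)) / (lam ^ n * (1 - lam))) atTop (𝓝 μ) := by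
    refine tendsto_div_of_hasDerivWithinAt_zero hgd hg0 (fun n => mul_pos (hpos n) (by linarith))
      (fun n => mul_le_one₀ (hle n) (by linarith) (by linarith)) ?_
    simpa using hpow.mul_const (1 - lam)
  set c := lam * (1 - 2 * lam) / (1 - lam) with hc
  have h1l : 0 < 1 - lam := by linarith
  -- This follows the image of the gap from `lam ^ (n + 1)` to `lam ^ n * (1 - lam)`: its length
  -- minus `c` times its left endpoint, all divided by `lam ^ n`. The limit is positive because `1 -
  -- lam - lam ^ 2 > 0`, so the second alternative of `gap_cases` eventually fails.
  have t3 := ((t2.mul_const (1 - lam)).sub (t1'.mul_const lam)).sub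
    ((t1'.mul_const lam).const_mul c)
  have hlim : 0 < μ * (1 - lam) - μ * lam - c * (μ * lam) := by
    have : μ * (1 - lam) - μ * lam - c * (μ * lam) =
        μ * (1 - 2 * lam) * (1 - lam - lam ^ 2) / (1 - lam) := by
      rw [hc]; field_simp; ring
    rw [this]
    exact div_pos (mul_pos (mul_pos hμ0 (by linarith)) (by nlinarith)) h1l
  have hbig : ∀ᶠ n : ℕ in atTop, ∃ j : ℕ, g (lam ^ (n + 1)) = lam ^ j := by
    filter_upwards [t3.eventually_const_lt hlim] with n hn
    have hx1 : lam ^ (n + 1) ∈ X := by simpa using hX.pow_mul_mem (hX.one_mem h1) (n + 1)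
    have hx2 : lam ^ n * (1 - lam) ∈ X := hX.pow_mul_mem (hX.one_sub_mem h1) n
    have hlt : lam ^ (n + 1) < lam ^ n * (1 - lam) := by
      rw [pow_succ]; exact mul_lt_mul_of_pos_left (by linarith) (hpos n)
    -- A point of `X` in the image interval pulls back under `g` to a point of `X` between `lam ^ (n
    -- + 1)` and `lam ^ n * (1 - lam)`. Rescaling `n` times would place a point of `X` in the
    -- central gap.
    have hgap : ∀ x ∈ X, ¬(g (lam ^ (n + 1)) < x ∧ x < g (lam ^ n * (1 - lam))) := by
      rintro x hx ⟨hxl, hxr⟩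
      have hg1 := hgmono.monotoneOn (hX.subset hx2) one_mem_I (hX.subset hx2).2
      obtain ⟨z, hz, rfl⟩ := hgsurj x hx (hxr.le.trans hg1)
      rw [hgmono.lt_iff_lt (hX.subset hx1) (hX.subset hz)] at hxl
      rw [hgmono.lt_iff_lt (hX.subset hz) (hX.subset hx2)] at hxr
      clear hn
      induction n generalizing z with
      | zero =>
        rw [zero_add, pow_one] at hxl
        rw [pow_zero, one_mul] at hxr
        obtain ⟨y, hy, rfl⟩ := hX.mem_of_le h0 hz hxr
        have := mul_le_of_le_one_right h0.le (hX.subset hy).2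
        linarith
      | succ n ih =>
        have hlt1 : lam ^ (n + 1) * (1 - lam) ≤ 1 - lam := mul_le_of_le_one_left h1l.le (hle _)
        obtain ⟨y, hy, rfl⟩ := hX.mem_of_le h0 hz (by linarith)
        rw [pow_succ' _ (n + 1)] at hxl
        rw [pow_succ', mul_assoc] at hxr
        have e1 := lt_of_mul_lt_mul_left hxl h0.le
        have e2 := lt_of_mul_lt_mul_left hxr h0.le
        have hy1 : lam ^ (n + 1) ∈ X := by simpa using hX.pow_mul_mem (hX.one_mem h1) (n + 1)
        have hy2 : lam ^ n * (1 - lam) ∈ X := hX.pow_mul_mem (hX.one_sub_mem h1) n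
        exact ih hy1 hy2 (by rw [pow_succ]; exact mul_lt_mul_of_pos_left (by linarith) (hpos n))
          (hgmono.monotoneOn (hX.subset hy2) one_mem_I (hX.subset hy2).2) y hy (hgX y hy) e1 e2
    have hg0lt : 0 < g (lam ^ (n + 1)) := by
      have := hgmono zero_mem_I (hX.subset hx1) (hpos (n + 1))
      rwa [hg0] at this
    rcases hX.gap_cases h0 h1 (hgX _ hx1) (hgX _ hx2) hg0lt
      (hgmono (hX.subset hx1) (hX.subset hx2) hlt) hgap with hj | hshort
    · exact hj
    · exfalso
      have hp := hpos n
      have e : g (lam ^ n * (1 - lam)) / (lam ^ n * (1 - lam)) * (1 - lam) -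
          g (lam ^ (n + 1)) / lam ^ (n + 1) * lam - c * (g (lam ^ (n + 1)) / lam ^ (n + 1) * lam) =
          (g (lam ^ n * (1 - lam)) - g (lam ^ (n + 1)) - c * g (lam ^ (n + 1))) / lam ^ n := by
        rw [pow_succ]; field_simp
      simp only [Function.comp_apply] at hn
      rw [e, div_pos_iff_of_pos_right hp] at hn
      linarith
  have hlog : Real.log lam < 0 := Real.log_neg h0 hlam1
  -- In base `lam`, the logarithm of `g x / x` is eventually an integer along the powers of `lam`.
  -- It converges, hence is eventually a constant `K`, and `μ < 1` makes `K` positive.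
  have t4 : Tendsto (fun n => Real.log (g (lam ^ (n + 1)) / lam ^ (n + 1)) / Real.log lam) atTop
      (𝓝 (Real.log μ / Real.log lam)) :=
    ((Real.continuousAt_log hμ0.ne').tendsto.comp t1').div_const _
  have hval : ∀ n j : ℕ, g (lam ^ (n + 1)) = lam ^ j →
      Real.log (g (lam ^ (n + 1)) / lam ^ (n + 1)) / Real.log lam = ((j - (n + 1) : ℤ) : ℝ) := by
    intro n j hj
    rw [hj, Real.log_div (hpos j).ne' (hpos _).ne', Real.log_pow, Real.log_pow, ← sub_mul,
      mul_div_cancel_right₀ _ hlog.ne]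
    push_cast
    ring
  obtain ⟨K, hK, hev⟩ := eventually_eq_intCast_of_tendsto t4
    (hbig.mono fun n ⟨j, hj⟩ => ⟨j - (n + 1), (hval n j hj).symm⟩)
  have hK0 : 0 < K := by
    have : 0 < Real.log μ / Real.log lam := div_pos_of_neg_of_neg (Real.log_neg hμ0 hμ1) hlog
    rw [hK] at this
    exact_mod_cast this
  lift K to ℕ using hK0.le
  refine ⟨K, by omega, ?_⟩
  have hfin : ∀ᶠ n : ℕ in atTop, f 0 (h (lam ^ (n + 1))) = h (lam ^ (n + 1 + K)) := by
    filter_upwards [hbig, hev] with n ⟨j, hj⟩ hn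
    rw [hval n j hj] at hn
    have hn' : (j - (n + 1) : ℤ) = K := by exact_mod_cast hn
    have : j = n + 1 + K := by omega
    rw [← hhg _ ⟨(hpos _).le, hle _⟩, hj, this]
  obtain ⟨N, hN⟩ := hfin.exists_forall_of_atTop
  filter_upwards [eventually_ge_atTop (N + 1)] with n hn
  obtain ⟨m, rfl⟩ : ∃ m, n = m + 1 := ⟨n - 1, by omega⟩
  exact hN m (by omega)

end Rigidity

/-! ### Existence of the self-similar Cantor set -/

/-- The attractor is the set of sums `∑ b (x n) * lam ^ n` with digits 0 and `1 - lam`. It is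
compact as a continuous image of the space of binary sequences, and invariance is the removal or
prepending of a digit. -/
theorem exists_isAttractor_selfSimilarIFS {lam : ℝ} (h0 : 0 < lam) (h1 : lam < 1 / 2) :
    ∃ X, IsAttractor (selfSimilarIFS lam) X := by
  have hl : 0 < 1 - lam := by linarith
  set b : Bool → ℝ := fun i => if i then 1 - lam else 0 with hb
  have hb0 : ∀ i, 0 ≤ b i := fun i => by cases i <;> simp [hb]; linarith
  have hb1 : ∀ i, b i ≤ 1 - lam := fun i => by cases i <;> simp [hb]; linarith
  have hgeo : HasSum (fun n : ℕ => (1 - lam) * lam ^ n) 1 := by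
    have := (hasSum_geometric_of_lt_one h0.le (by linarith)).mul_left (1 - lam)
    rwa [mul_inv_cancel₀ hl.ne'] at this
  have hle : ∀ (n : ℕ) (x : ℕ → Bool), b (x n) * lam ^ n ≤ (1 - lam) * lam ^ n := fun n x =>
    mul_le_mul_of_nonneg_right (hb1 _) (pow_pos h0 n).le
  have hnn : ∀ (n : ℕ) (x : ℕ → Bool), 0 ≤ b (x n) * lam ^ n := fun n x =>
    mul_nonneg (hb0 _) (pow_pos h0 n).le
  have hsum : ∀ x : ℕ → Bool, Summable fun n => b (x n) * lam ^ n := fun x =>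
    Summable.of_nonneg_of_le (fun n => hnn n x) (fun n => hle n x) hgeo.summable
  set φ : (ℕ → Bool) → ℝ := fun x => ∑' n, b (x n) * lam ^ n with hφ
  have hcont : Continuous φ := by
    refine continuous_tsum (u := fun n => (1 - lam) * lam ^ n) (fun n => ?_) hgeo.summable
      fun n x => ?_
    · exact ((continuous_of_discreteTopology (f := b)).comp (continuous_apply n)).mul
        continuous_const
    · rw [Real.norm_of_nonneg (hnn n x)]; exact hle n x
  have hstep : ∀ x, φ x = b (x 0) + lam * φ fun n => x (n + 1) := fun x => by
    rw [hφ]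
    simp only
    rw [(hsum x).tsum_eq_zero_add, ← tsum_mul_left, pow_zero, mul_one]
    congr 1
    exact tsum_congr fun n => by ring
  have hcons : ∀ (i : Bool) (x : ℕ → Bool),
      φ (fun n => Nat.casesOn n i x) = lam * φ x + b i := fun i x =>
    (hstep _).trans (add_comm _ _)
  refine ⟨range φ, ?_, range_nonempty φ, isCompact_range hcont, ?_⟩
  · rintro _ ⟨x, rfl⟩
    refine ⟨tsum_nonneg fun n => hnn n x, ?_⟩
    exact ((hsum x).tsum_le_tsum (fun n => hle n x) hgeo.summable).trans hgeo.tsum_eq.le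
  · apply Subset.antisymm
    · rintro _ ⟨x, rfl⟩
      rw [hstep x]
      cases hx : x 0
      · exact Or.inl ⟨_, ⟨fun n => x (n + 1), rfl⟩, by simp [selfSimilarIFS, hb]⟩
      · exact Or.inr ⟨_, ⟨fun n => x (n + 1), rfl⟩, by simp [selfSimilarIFS, hb, add_comm]⟩
    · rintro _ (⟨_, ⟨x, rfl⟩, rfl⟩ | ⟨_, ⟨x, rfl⟩, rfl⟩)
      · exact ⟨_, (hcons false x).trans (by simp [selfSimilarIFS, hb])⟩
      · exact ⟨_, (hcons true x).trans (by simp [selfSimilarIFS, hb])⟩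

/-! ### Taylor approximation -/

open Polynomial in
theorem exists_polynomial_derivative_eq (P : ℝ[X]) : ∃ Q : ℝ[X], derivative Q = P := by
  induction P using Polynomial.induction_on' with
  | add p q hp hq =>
    obtain ⟨p', rfl⟩ := hp
    obtain ⟨q', rfl⟩ := hq
    exact ⟨p' + q', by simp⟩
  | monomial n a =>
    refine ⟨monomial (n + 1) (a / (n + 1)), ?_⟩
    rw [derivative_monomial, Nat.add_sub_cancel]
    congr 1
    push_cast
    field_simp

/-- Induction on the order: integrate the polynomial for the derivative, match the value at 0, and
bound the remainder by the mean value theorem. -/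
theorem HolderDeriv.exists_taylor {α : ℝ} {r : ℕ} {f : ℝ → ℝ} (hα : 0 < α)
    (hf : HolderDeriv α r f) :
    ∃ (P : Polynomial ℝ) (C : ℝ), 0 ≤ C ∧ ∀ x ∈ I, |f x - P.eval x| ≤ C * x ^ (r + α) := by
  induction r generalizing f with
  | zero =>
    obtain ⟨A, hA, H⟩ := hf
    refine ⟨Polynomial.C (f 0), A, hA.le, fun x hx => ?_⟩
    have := H 0 zero_mem_I x hx
    rw [sub_zero, abs_of_nonneg hx.1] at this
    simpa using this
  | succ r ih =>
    obtain ⟨f', h1, h2⟩ := hf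
    obtain ⟨P', C, hC, hP'⟩ := ih h2
    obtain ⟨P, rfl⟩ := exists_polynomial_derivative_eq P'
    refine ⟨P + Polynomial.C (f 0 - P.eval 0), C, hC, fun x hx => ?_⟩
    have hrα : 0 < (r : ℝ) + α := by positivity
    rcases hx.1.eq_or_lt with rfl | hx0
    · rw [Real.zero_rpow (by push_cast; positivity)]
      simp
    have hd : ∀ y ∈ I, HasDerivWithinAt (fun y => f y - P.eval y)
        (f' y - (Polynomial.derivative P).eval y) I y :=
      fun y hy => (h1 y hy).sub (P.hasDerivAt y).hasDerivWithinAt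
    obtain ⟨c, hc, e⟩ := exists_slope_eq hd le_rfl hx0 hx.2
    have hcI : c ∈ I := ⟨hc.1.le, hc.2.le.trans hx.2⟩
    have e2 : f x - (P + Polynomial.C (f 0 - P.eval 0)).eval x =
        (f' c - (Polynomial.derivative P).eval c) * x := by
      rw [Polynomial.eval_add, Polynomial.eval_C]
      linarith
    rw [e2, abs_mul, abs_of_pos hx0]
    calc |f' c - (Polynomial.derivative P).eval c| * x ≤ C * c ^ (r + α) * x := by
          gcongr; exact hP' c hcI
      _ ≤ C * x ^ (r + α) * x := by
          gcongr
          exacts [hc.1.le, hc.2.le]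
      _ = C * x ^ ((r + 1 : ℕ) + α) := by
          rw [mul_assoc, ← Real.rpow_add_one hx0.ne']
          push_cast
          ring_nf

theorem tendsto_rpow_nhds_zero {x : ℕ → ℝ} (hx : Tendsto x atTop (𝓝 0)) {p : ℝ} (hp : 0 < p) :
    Tendsto (fun n => x n ^ p) atTop (𝓝 0) := by
  have := hx.rpow_const (p := p) (Or.inr hp.le)
  rwa [Real.zero_rpow hp.ne'] at this

-- Write `Q = X ^ m * R` with `R 0 ≠ 0`. If `m < s` the quotient would be unbounded; since `s` is
-- not an integer, `m > s > 1`, so the quotient tends to 0 and `Q` has no linear term.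
open Polynomial in
theorem eq_zero_of_tendsto_eval_div_rpow {Q : ℝ[X]} {s L : ℝ} (hs : 1 < s)
    (hint : ∀ m : ℕ, (m : ℝ) ≠ s) {x : ℕ → ℝ} (hx0 : ∀ n, 0 < x n)
    (hx : Tendsto x atTop (𝓝 0)) (hQ : Tendsto (fun n => Q.eval (x n) / x n ^ s) atTop (𝓝 L)) :
    L = 0 ∧ (derivative Q).eval 0 = 0 := by
  rcases eq_or_ne Q 0 with rfl | hQ0
  · simp only [eval_zero, zero_div] at hQ
    exact ⟨tendsto_nhds_unique hQ tendsto_const_nhds, by simp⟩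
  obtain ⟨R, hR, hdvd⟩ := Q.exists_eq_pow_rootMultiplicity_mul_and_not_dvd hQ0 0
  set m := Q.rootMultiplicity 0
  rw [map_zero, sub_zero] at hR hdvd
  rw [X_dvd_iff, coeff_zero_eq_eval_zero] at hdvd
  have hRt : Tendsto (fun n => R.eval (x n)) atTop (𝓝 (R.eval 0)) :=
    (R.continuous.tendsto 0).comp hx
  rcases lt_or_gt_of_ne (hint m) with hm | hm
  · exfalso
    have h2 := hQ.mul (tendsto_rpow_nhds_zero hx (sub_pos.2 hm))
    rw [mul_zero] at h2
    refine hdvd (tendsto_nhds_unique hRt (h2.congr fun n => ?_))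
    have := (Real.rpow_pos_of_pos (hx0 n) s).ne'
    have h3 := (pow_pos (hx0 n) m).ne'
    rw [Real.rpow_sub (hx0 n), Real.rpow_natCast, hR, eval_mul, eval_pow, eval_X]
    field_simp
  · constructor
    · have h2 := (tendsto_rpow_nhds_zero hx (sub_pos.2 hm)).mul hRt
      rw [zero_mul] at h2
      refine tendsto_nhds_unique hQ (h2.congr fun n => ?_)
      rw [Real.rpow_sub (hx0 n), Real.rpow_natCast, hR, eval_mul, eval_pow, eval_X]
      ring
    · have h2 : 1 < m := by exact_mod_cast hs.trans hm
      obtain ⟨j, hj⟩ : ∃ j, m = j + 2 := ⟨m - 2, by omega⟩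
      rw [hR, hj]
      simp [derivative_mul]

/-! ### A Cantor set of class `C^s` which is not of class `C^t` -/

theorem IsHyperbolicIFS.mono {S T : Regularity} (hST : ∀ g, IsOfClass S g → IsOfClass T g)
    {f : Fin 2 → ℝ → ℝ} (hf : IsHyperbolicIFS S f) : IsHyperbolicIFS T f :=
  ⟨fun i => hST _ (hf.isOfClass i), hf.deriv_bounds, hf.zero_zero, hf.zero_one_pos, hf.separated,
    hf.one_zero_lt, hf.one_one⟩

/-- At 0 the map `F` is a polynomial `P` up to `o(x ^ s)`. The linear terms give `P' 0 = lam ^ K`,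
while the `x ^ s` terms give `P' 0 = (lam ^ K) ^ s`; these differ because `s > 1`. -/
theorem not_forall_powers_shift {F : ℝ → ℝ} {lam s t b c : ℝ} (h0 : 0 < lam) (h1 : lam < 1)
    (hs : 1 < s) (hint : ∀ m : ℕ, (m : ℝ) ≠ s) (hst : s < t) (hb : 0 < b) (hc : 0 < c)
    (hbc : b + c = 1) (hF : IsOfClass (.finite t) F) {K : ℕ} (hK : 1 ≤ K)
    (hshift : ∀ᶠ n : ℕ in atTop, F (b * lam ^ n + c * (lam ^ n) ^ s) =
      b * lam ^ (n + K) + c * (lam ^ (n + K)) ^ s) : False := by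
  obtain ⟨r, α, -, hα, -, rfl, hFr⟩ := (isOfClass_finite_iff (hs.trans hst)).1 hF
  obtain ⟨P, C, hC, hP⟩ := hFr.exists_taylor hα
  set x : ℕ → ℝ := fun n => lam ^ n with hxdef
  have hx0 : ∀ n, 0 < x n := fun n => pow_pos h0 n
  have hx1 : ∀ n, x n ≤ 1 := fun n => pow_le_one₀ h0.le h1.le
  have hx : Tendsto x atTop (𝓝 0) := tendsto_pow_atTop_nhds_zero_of_lt_one h0.le h1
  have hxs : Tendsto (fun n => x n ^ s) atTop (𝓝 0) := tendsto_rpow_nhds_zero hx (by linarith)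
  have hxs0 : ∀ n, 0 < x n ^ s := fun n => Real.rpow_pos_of_pos (hx0 n) s
  set y : ℕ → ℝ := fun n => b * x n + c * x n ^ s with hy
  have hy0 : ∀ n, 0 < y n := fun n => add_pos (mul_pos hb (hx0 n)) (mul_pos hc (hxs0 n))
  have hyx : ∀ n, y n ≤ x n := fun n => by
    have h2 : x n ^ s ≤ x n := Real.rpow_le_self_of_le_one (hx0 n).le (hx1 n) hs.le
    calc y n ≤ b * x n + c * x n :=
        add_le_add le_rfl (mul_le_mul_of_nonneg_left h2 hc.le)
      _ = x n := by rw [← add_mul, hbc, one_mul]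
  have hyt : Tendsto y atTop (𝓝 0) := by simpa using (hx.const_mul b).add (hxs.const_mul c)
  have hbt : Tendsto (fun n => b * x n) atTop (𝓝 0) := by simpa using hx.const_mul b
  have t1 : Tendsto (fun n => (F (y n) - P.eval (y n)) / x n ^ s) atTop (𝓝 0) := by
    have h2 := (tendsto_rpow_nhds_zero hx (sub_pos.2 hst)).const_mul C
    rw [mul_zero] at h2
    refine squeeze_zero_norm (fun n => ?_) h2
    rw [norm_div, Real.norm_of_nonneg (hxs0 n).le, div_le_iff₀ (hxs0 n), mul_assoc,
      ← Real.rpow_add (hx0 n), sub_add_cancel]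
    refine (hP (y n) ⟨(hy0 n).le, (hyx n).trans (hx1 n)⟩).trans ?_
    have := hy0 n
    have := hyx n
    gcongr
  have t2 : Tendsto (fun n => (P.eval (y n) - P.eval (b * x n)) / x n ^ s) atTop
      (𝓝 ((Polynomial.derivative P).eval 0 * c)) := by
    have h2 : ∀ n, ∃ ξ ∈ Ioo (b * x n) (y n), (Polynomial.derivative P).eval ξ =
        (P.eval (y n) - P.eval (b * x n)) / (y n - b * x n) := fun n =>
      exists_hasDerivAt_eq_slope (fun z => P.eval z) (fun z => (Polynomial.derivative P).eval z)
        (lt_add_of_pos_right _ (mul_pos hc (hxs0 n))) P.continuous.continuousOn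
        fun z _ => P.hasDerivAt z
    choose ξ hξ hξe using h2
    have hξt : Tendsto ξ atTop (𝓝 0) := tendsto_of_tendsto_of_tendsto_of_le_of_le hbt hyt
      (fun n => (hξ n).1.le) fun n => (hξ n).2.le
    have h3 := (((Polynomial.derivative P).continuous.tendsto 0).comp hξt).mul_const c
    refine h3.congr fun n => ?_
    have e : y n - b * x n = c * x n ^ s := add_sub_cancel_left _ _
    have := (hxs0 n).ne'
    rw [Function.comp_apply, hξe, e]
    field_simp
  -- `Q` collects the genuinely polynomial part of the shift relation after the perturbation `c * x
  -- ^ s` is removed from the argument of `P`. What remains is `x ^ s` times a convergent factor.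
  set Q : Polynomial ℝ := P.comp (Polynomial.C b * Polynomial.X) -
    Polynomial.C (b * lam ^ K) * Polynomial.X with hQ
  have hQe : ∀ z, Q.eval z = P.eval (b * z) - b * lam ^ K * z := fun z => by
    simp [hQ, Polynomial.eval_comp]
  have t3 : Tendsto (fun n => Q.eval (x n) / x n ^ s) atTop
      (𝓝 (c * (lam ^ K) ^ s - 0 - (Polynomial.derivative P).eval 0 * c)) := by
    refine ((tendsto_const_nhds.sub t1).sub t2).congr' ?_
    filter_upwards [hshift] with n hn
    have e1 : F (y n) = b * (lam ^ K * x n) + c * ((lam ^ K) ^ s * x n ^ s) := by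
      rw [← Real.mul_rpow (pow_pos h0 K).le (hx0 n).le]
      rw [pow_add, mul_comm (lam ^ n) (lam ^ K)] at hn
      exact hn
    have := (hxs0 n).ne'
    rw [hQe, e1]
    field_simp
    ring
  obtain ⟨hL, hd⟩ := eq_zero_of_tendsto_eval_div_rpow hs hint hx0 hx t3
  have e2 : (Polynomial.derivative Q).eval 0 =
      b * (Polynomial.derivative P).eval 0 - b * lam ^ K := by
    simp [hQ, Polynomial.derivative_comp, Polynomial.eval_comp]
  rw [e2, ← mul_sub] at hd
  have e3 : (Polynomial.derivative P).eval 0 = lam ^ K :=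
    sub_eq_zero.1 ((mul_eq_zero.1 hd).resolve_left hb.ne')
  rw [e3, sub_zero, mul_comm c, ← sub_mul] at hL
  have e4 : (lam ^ K) ^ s = lam ^ K := sub_eq_zero.1 ((mul_eq_zero.1 hL).resolve_right hc.ne')
  have hlt := Real.rpow_lt_self_of_lt_one (pow_pos h0 K) (pow_lt_one₀ h0.le h1 (by omega)) hs
  exact hlt.ne e4

theorem exists_mem_equivClass_not_finite_of_noninteger {lam : ℝ} (h0 : 0 < lam)
    (h1 : lam < 1 / 2) {X : Set ℝ} (hX : IsAttractor (selfSimilarIFS lam) X) {r : ℕ} {α t : ℝ}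
    (hr : 1 ≤ r) (hα : 0 < α) (hα1 : α < 1) (hst : r + α < t) :
    ∃ Y ∈ equivClass lam (.finite (r + α)) X, ¬IsHyperbolicCantorSet (.finite t) Y := by
  set s : ℝ := r + α with hs
  have hr1 : (1 : ℝ) ≤ r := by exact_mod_cast hr
  have hs1 : 1 < s := by linarith
  have hint : ∀ m : ℕ, (m : ℝ) ≠ s := by
    intro m hm
    have h2 : r < m := by
      have : (r : ℝ) < m := by linarith
      exact_mod_cast this
    have h3 : m < r + 1 := by
      have : (m : ℝ) < (r + 1 : ℕ) := by push_cast; linarith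
      exact_mod_cast this
    omega
  -- With this choice `c * s = (1 - c) / 2`, so `h'` ranges in `[1 - c, 3 / 2 * (1 - c)]`, as the
  -- pinching requires.
  set c : ℝ := 1 / (2 * s + 1) with hc
  have hc0 : 0 < c := by positivity
  have hcs : c * (2 * s + 1) = 1 := by rw [hc]; field_simp
  have hb0 : 0 < 1 - c := by nlinarith
  set h : ℝ → ℝ := fun x => (1 - c) * x + c * x ^ s with hh
  have hd : ∀ x ∈ I, HasDerivWithinAt h (1 - c + c * (s * x ^ (s - 1))) I x := fun x _ => by
    have e1 := ((hasDerivAt_id x).const_mul (1 - c)).add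
      ((Real.hasDerivAt_rpow_const (x := x) (p := s) (Or.inr hs1.le)).const_mul c)
    rw [mul_one] at e1
    exact e1.hasDerivWithinAt
  have hpow : ∀ x ∈ I, 0 ≤ x ^ (s - 1) ∧ x ^ (s - 1) ≤ 1 := fun x hx =>
    ⟨Real.rpow_nonneg hx.1 _, Real.rpow_le_one hx.1 hx.2 (by linarith)⟩
  have hcs0 : 0 < c * s := by positivity
  obtain ⟨k, H⟩ := exists_isUnitDiffeo (h := h) hb0 hd
    (by
      refine continuousOn_const.add (continuousOn_const.mul (continuousOn_const.mul ?_))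
      exact continuousOn_id.rpow_const fun x _ => Or.inr (by linarith))
    (fun x hx => by
      have := mul_nonneg hcs0.le (hpow x hx).1
      linarith)
    (fun x hx => by
      have := mul_le_mul_of_nonneg_left (hpow x hx).2 hcs0.le
      linarith)
    (by simp [hh, Real.zero_rpow (by linarith : s ≠ 0)]) (by simp [hh])
  have hreg : HolderDeriv α r h :=
    ((HolderDeriv.const _).mul hα hα1.le (.id hα hα1.le)).add
      ((HolderDeriv.const _).mul hα hα1.le (.rpow hα hα1.le))
  have hclass : ∀ {g : ℝ → ℝ}, HolderDeriv α r g → IsOfClass (.finite s) g := fun hg =>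
    (isOfClass_finite_iff hs1).2 ⟨r, α, hr, hα, hα1.le, rfl, hg⟩
  refine ⟨h '' X, H.image_mem_equivClass h0 h1 hX (hclass hreg)
    (hclass (H.holderDeriv_inv hα hα1.le hreg))
    fun i => hclass (H.holderDeriv_conjIFS h0 h1 hα hα1.le hreg i), ?_⟩
  rintro ⟨f, hf, hY⟩
  have hf1 : IsHyperbolicIFS (.finite 1) f := hf.mono fun g hg => hg.finite_one fun s' hs' => by
    injection hs' with hs'
    linarith
  obtain ⟨K, hK, hshift⟩ := H.exists_shift h0 h1 hX hf1 hY
  exact not_forall_powers_shift h0 (by linarith) hs1 hint hst hb0 hc0 (by ring)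
    (hf.isOfClass 0) hK hshift

/-- Choosing the exponent strictly between `s` and `⌊s⌋₊ + 1` keeps it away from the integers, where
`x ^ s` would be a polynomial and give no obstruction. -/
theorem exists_nat_add_between {s t : ℝ} (hs : 1 < s) (hst : s < t) :
    ∃ (r : ℕ) (α : ℝ), 1 ≤ r ∧ 0 < α ∧ α < 1 ∧ s < r + α ∧ r + α < t := by
  have h1 := Nat.floor_le (zero_le_one.trans hs.le)
  have h2 := Nat.lt_floor_add_one s
  have h3 : 1 ≤ ⌊s⌋₊ := Nat.le_floor (by exact_mod_cast hs.le)
  obtain ⟨u, hu1, hu2⟩ := exists_between (lt_min hst h2)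
  have hu3 := hu2.trans_le (min_le_left _ _)
  have hu4 := hu2.trans_le (min_le_right _ _)
  exact ⟨⌊s⌋₊, u - ⌊s⌋₊, h3, by linarith, by linarith, by linarith, by linarith⟩

/-! ### A smooth Cantor set which is not analytic -/

/-- The powers of `lam` accumulate at 0, so the identity theorem applies to an analytic extension of
`F` across this endpoint. The equality then spreads over the connected open interval. -/
theorem eqOn_of_analyticOn_of_powers {F : ℝ → ℝ} (hF : AnalyticOn ℝ F I) {lam m : ℝ}
    (h0 : 0 < lam) (h1 : lam < 1) (hpow : ∀ᶠ n : ℕ in atTop, F (lam ^ n) = m * lam ^ n) :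
    EqOn F (fun x => m * x) (Ioo 0 1) := by
  obtain ⟨g, hFg, hg⟩ := analyticWithinAt_iff_exists_analyticAt.1 (hF 0 zero_mem_I)
  rw [insert_eq_of_mem zero_mem_I] at hFg
  have hpos : ∀ n : ℕ, 0 < lam ^ n := fun n => pow_pos h0 n
  have hx : Tendsto (fun n : ℕ => lam ^ n) atTop (𝓝 0) :=
    tendsto_pow_atTop_nhds_zero_of_lt_one h0.le h1
  have hxI : Tendsto (fun n : ℕ => lam ^ n) atTop (𝓝[I] 0) := tendsto_nhdsWithin_iff.2
    ⟨hx, Eventually.of_forall fun n => ⟨(hpos n).le, pow_le_one₀ h0.le h1.le⟩⟩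
  have hxne : Tendsto (fun n : ℕ => lam ^ n) atTop (𝓝[≠] 0) := tendsto_nhdsWithin_iff.2
    ⟨hx, Eventually.of_forall fun n => (hpos n).ne'⟩
  have hlin : ∀ z, AnalyticAt ℝ (fun x : ℝ => m * x) z := fun z =>
    analyticAt_const.mul analyticAt_id
  have hfreq : ∃ᶠ z in 𝓝[≠] (0 : ℝ), g z = m * z := by
    refine hxne.frequently (Eventually.frequently ?_)
    filter_upwards [hpow, hxI.eventually hFg] with n e1 e2
    rw [← e2, e1]
  have hev : ∀ᶠ z in 𝓝 (0 : ℝ), g z = m * z :=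
    (hg.frequently_eq_iff_eventually_eq (hlin 0)).1 hfreq
  have hFev : ∀ᶠ z in 𝓝 (0 : ℝ), z ∈ I → F z = m * z := by
    filter_upwards [hev, eventually_nhdsWithin_iff.1 hFg] with z e1 e2 hz
    rw [e2 hz, e1]
  obtain ⟨ε, hε, hball⟩ := Metric.eventually_nhds_iff.1 hFev
  have hz : 0 < min (ε / 2) (1 / 2) := by positivity
  have hzε : min (ε / 2) (1 / 2) < ε := (min_le_left _ _).trans_lt (by linarith)
  have hz1 : min (ε / 2) (1 / 2) < 1 := (min_le_right _ _).trans_lt (by norm_num)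
  have hA : AnalyticOnNhd ℝ F (Ioo 0 1) :=
    isOpen_Ioo.analyticOn_iff_analyticOnNhd.1 (hF.mono Ioo_subset_Icc_self)
  refine hA.eqOn_of_preconnected_of_eventuallyEq (fun z _ => hlin z) isPreconnected_Ioo
    ⟨hz, hz1⟩ ?_
  filter_upwards [Ioo_mem_nhds hz (lt_min hzε hz1)] with y hy
  have hy2 := hy.2.trans_le (min_le_left _ _)
  have hy3 := hy.2.trans_le (min_le_right _ _)
  refine hball ?_ ⟨hy.1.le, hy3.le⟩
  rwa [Real.dist_eq, sub_zero, abs_of_pos hy.1]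

theorem exists_mem_equivClass_smooth_not_analytic {lam : ℝ} (h0 : 0 < lam) (h1 : lam < 1 / 2)
    {X : Set ℝ} (hX : IsAttractor (selfSimilarIFS lam) X) :
    ∃ Y ∈ equivClass lam .smooth X, ¬IsHyperbolicCantorSet .analytic Y := by
  -- The perturbation vanishes on `[0, lam]` and at 1 but is positive in between, so it moves the
  -- right end of the central gap and leaves the left piece fixed.
  set φ : ℝ → ℝ := fun x => expNegInvGlue (x - lam) * (1 - x) with hφ
  have hφs : ContDiff ℝ ∞ φ :=
    (expNegInvGlue.contDiff.comp (contDiff_id.sub contDiff_const)).mul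
      (contDiff_const.sub contDiff_id)
  have hφd : Continuous (deriv φ) := hφs.continuous_deriv (by simp)
  obtain ⟨C, hC, hb⟩ := exists_abs_le_of_continuousOn hφd.continuousOn
  -- This makes `|c * φ'| ≤ 1/5`, so `h'` lies in `[4/5, 6/5]`, and `6/5` is `3/2` times `4/5`.
  set c : ℝ := 1 / (5 * (C + 1)) with hc
  have hc0 : 0 < c := by positivity
  have hcC : c * (C + 1) = 1 / 5 := by rw [hc]; field_simp
  set h : ℝ → ℝ := fun x => x + c * φ x with hh
  have hfix : ∀ x, x ≤ lam → h x = x := fun x hx => by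
    simp [hh, hφ, expNegInvGlue.zero_of_nonpos (sub_nonpos.2 hx)]
  have hd : ∀ x ∈ I, HasDerivWithinAt h (1 + c * deriv φ x) I x := fun x _ =>
    ((hasDerivAt_id x).add (((hφs.differentiable (by simp)) x).hasDerivAt.const_mul
      c)).hasDerivWithinAt
  have hbd : ∀ x ∈ I, |c * deriv φ x| ≤ 1 / 5 := fun x hx => by
    rw [abs_mul, abs_of_pos hc0, ← hcC]
    have := hb x hx
    gcongr
    linarith
  obtain ⟨k, H⟩ := exists_isUnitDiffeo (h := h) (a := 4 / 5) (by norm_num) hd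
    (by fun_prop) (fun x hx => by linarith [(abs_le.1 (hbd x hx)).1])
    (fun x hx => by linarith [(abs_le.1 (hbd x hx)).2]) (hfix 0 h0.le) (by simp [hh, hφ])
  have hreg : ∀ r, HolderDeriv 1 r h := HolderDeriv.forall_iff_contDiffOn.2
    (contDiff_id.add (contDiff_const.mul hφs)).contDiffOn
  refine ⟨h '' X, H.image_mem_equivClass h0 h1 hX (HolderDeriv.forall_iff_contDiffOn.1 hreg)
    (HolderDeriv.forall_iff_contDiffOn.1 fun r => H.holderDeriv_inv one_pos le_rfl (hreg r))
    fun i => HolderDeriv.forall_iff_contDiffOn.1 fun r =>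
      H.holderDeriv_conjIFS h0 h1 one_pos le_rfl (hreg r) i, ?_⟩
  rintro ⟨f, hf, hY⟩
  have hf1 : IsHyperbolicIFS (.finite 1) f := hf.mono fun g hg => hg.finite_one fun _ hs' => by
    cases hs'
  obtain ⟨K, hK, hshift⟩ := H.exists_shift h0 h1 hX hf1 hY
  have hple : ∀ n : ℕ, 1 ≤ n → lam ^ n ≤ lam := fun n hn =>
    pow_le_of_le_one h0.le (by linarith) (by omega)
  have heq := eqOn_of_analyticOn_of_powers (m := lam ^ K) (hf.isOfClass 0) h0 (by linarith) (by
    filter_upwards [hshift, eventually_ge_atTop 1] with n hn hn1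
    rwa [hfix _ (hple n hn1), hfix _ (hple (n + K) (by omega)), pow_add, mul_comm] at hn)
  have hl : 1 - lam ∈ Ioo (0 : ℝ) 1 := ⟨by linarith, by linarith⟩
  have hlI : 1 - lam ∈ I := Ioo_subset_Icc_self hl
  -- This point lies in the left piece, where `h` is the identity. Linearity of `f 0` makes `1 -
  -- lam` its only preimage under `f 0`, so `1 - lam` must belong to `h '' X`.
  have hy : lam ^ K * (1 - lam) ∈ h '' X := by
    refine ⟨_, hX.pow_mul_mem (hX.one_sub_mem h1) K, hfix _ ?_⟩
    exact (mul_le_of_le_one_right (pow_pos h0 K).le hl.2.le).trans (hple K hK)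
  have hlt : f 0 (1 - lam) < f 0 1 := hf1.strictMonoOn 0 hlI one_mem_I hl.2
  rw [heq hl] at hlt
  obtain ⟨z, hz, hze⟩ := hf1.image_zero hY hy hlt.le
  have hz' : z = 1 - lam :=
    (hf1.strictMonoOn 0).injOn (hY.subset hz) hlI (hze.trans (heq hl).symm)
  obtain ⟨w, hw, rfl⟩ := hz
  have hgt : 1 - lam < h (1 - lam) := by
    have := expNegInvGlue.pos_of_pos (show 0 < 1 - lam - lam by linarith)
    rw [hh]
    simp only [hφ, sub_sub_cancel, lt_add_iff_pos_right]
    positivity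
  -- The point `w` of `X` with `h w = 1 - lam` lies left of `1 - lam`, hence in `[0, lam]`, where
  -- `h` is the identity. This forces `1 - lam ≤ lam`.
  have hwlt : w < 1 - lam := by
    rw [← hz'] at hgt
    refine (H.strictMonoOn.lt_iff_lt (hX.subset hw) hlI).1 ?_
    rw [hz'] at hgt ⊢
    exact hgt
  obtain ⟨y, hy, rfl⟩ := hX.mem_of_le h0 hw hwlt
  have hyl : lam * y ≤ lam := mul_le_of_le_one_right h0.le (hX.subset hy).2
  rw [hfix _ hyl] at hz'
  linarith

/-! ### Monotonicity in the regularity -/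

section Monotone

variable {S T : Regularity} {lam : ℝ}

theorem E_mono (hST : ∀ g, IsOfClass S g → IsOfClass T g) : E lam S ⊆ E lam T := by
  rintro X ⟨f, hf, hX, hs⟩
  exact ⟨f, hf.mono hST, hX, hs⟩

theorem equivClass_mono (hST : ∀ g, IsOfClass S g → IsOfClass T g) (X : Set ℝ) :
    equivClass lam S X ⊆ equivClass lam T X := by
  rintro Y ⟨hY, h, k, hh, hk, hrest⟩
  exact ⟨E_mono hST hY, h, k, hST h hh, hST k hk, hrest⟩

theorem isHyperbolicCantorSet_of_mem_E {X : Set ℝ} (hX : X ∈ E lam S) :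
    IsHyperbolicCantorSet S X := by
  obtain ⟨f, hf, hA, -⟩ := hX
  exact ⟨f, hf, hA⟩

/-- One witness separates both chains: membership in the smaller set of either chain would make it
an attractor of a system of class `S`. -/
theorem ssubset_of_exists (hST : ∀ g, IsOfClass S g → IsOfClass T g) {X : Set ℝ}
    (hex : ∃ Y ∈ equivClass lam T X, ¬IsHyperbolicCantorSet S Y) :
    E lam S ⊂ E lam T ∧ equivClass lam S X ⊂ equivClass lam T X := by
  obtain ⟨Y, hY, hn⟩ := hex
  exact ⟨⟨E_mono hST, fun h => hn (isHyperbolicCantorSet_of_mem_E (h hY.1))⟩,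
    equivClass_mono hST X, fun h => hn (isHyperbolicCantorSet_of_mem_E (h hY).1)⟩

theorem exists_mem_equivClass_not_finite (h0 : 0 < lam) (h1 : lam < 1 / 2) {X : Set ℝ}
    (hX : IsAttractor (selfSimilarIFS lam) X) {s t : ℝ} (hs : 1 < s) (hst : s < t) :
    ∃ Y ∈ equivClass lam (.finite s) X, ¬IsHyperbolicCantorSet (.finite t) Y := by
  obtain ⟨r, α, hr, hα, hα1, h2, h3⟩ := exists_nat_add_between hs hst
  obtain ⟨Y, hY, hn⟩ := exists_mem_equivClass_not_finite_of_noninteger h0 h1 hX hr hα hα1 h3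
  exact ⟨Y, equivClass_mono (fun g hg => hg.finite_mono hs h2.le) X hY, hn⟩

theorem analytic_ssubset_smooth (h0 : 0 < lam) (h1 : lam < 1 / 2) {X : Set ℝ}
    (hX : IsAttractor (selfSimilarIFS lam) X) :
    E lam .analytic ⊂ E lam .smooth ∧ equivClass lam .analytic X ⊂ equivClass lam .smooth X :=
  ssubset_of_exists (fun _ hg => hg.smooth_of_analytic)
    (exists_mem_equivClass_smooth_not_analytic h0 h1 hX)

theorem smooth_ssubset_finite (h0 : 0 < lam) (h1 : lam < 1 / 2) {X : Set ℝ}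
    (hX : IsAttractor (selfSimilarIFS lam) X) {t : ℝ} (ht : 1 < t) :
    E lam .smooth ⊂ E lam (.finite t) ∧
      equivClass lam .smooth X ⊂ equivClass lam (.finite t) X := by
  -- Any finite exponent above `t` serves here, since a smooth system is also of class `C^(t+1)`.
  obtain ⟨Y, hY, hn⟩ := exists_mem_equivClass_not_finite h0 h1 hX ht (lt_add_one t)
  refine ssubset_of_exists (fun _ hg => hg.finite_of_smooth ht) ⟨Y, hY, fun h => hn ?_⟩
  obtain ⟨f, hf, hA⟩ := h
  exact ⟨f, hf.mono fun _ hg => hg.finite_of_smooth (by linarith), hA⟩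

theorem finite_ssubset_finite (h0 : 0 < lam) (h1 : lam < 1 / 2) {X : Set ℝ}
    (hX : IsAttractor (selfSimilarIFS lam) X) {s t : ℝ} (hs : 1 < s) (hst : s < t) :
    E lam (.finite t) ⊂ E lam (.finite s) ∧
      equivClass lam (.finite t) X ⊂ equivClass lam (.finite s) X :=
  ssubset_of_exists (fun _ hg => hg.finite_mono hs hst.le)
    (exists_mem_equivClass_not_finite h0 h1 hX hs hst)

/-- The witnesses need an exponent above 1, so one is taken at some `u` in `(1, s)` and viewed as a
set of class `C^1`. -/
theorem finite_ssubset_one (h0 : 0 < lam) (h1 : lam < 1 / 2) {X : Set ℝ}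
    (hX : IsAttractor (selfSimilarIFS lam) X) {s : ℝ} (hs : 1 < s) :
    E lam (.finite s) ⊂ E lam (.finite 1) ∧
      equivClass lam (.finite s) X ⊂ equivClass lam (.finite 1) X := by
  have hone : ∀ {u : ℝ}, 1 < u → ∀ g, IsOfClass (.finite u) g → IsOfClass (.finite 1) g :=
    fun hu g hg => hg.finite_one fun s' hs' => by injection hs' with hs'; linarith
  obtain ⟨u, hu1, hus⟩ := exists_between hs
  obtain ⟨Y, hY, hn⟩ := exists_mem_equivClass_not_finite h0 h1 hX hu1 hus
  exact ssubset_of_exists (hone hs) ⟨Y, equivClass_mono (hone hu1) X hY, hn⟩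

end Monotone

end HyperbolicCantor

theorem mainTheorem4 (lam : ℝ) (hlam₀ : 0 < lam) (hlam₁ : lam < 1 / 2) :
    -- the hyperbolic Cantor sets with constant scaling function form a strictly decreasing chain
    (HyperbolicCantor.E lam .analytic ⊂ HyperbolicCantor.E lam .smooth ∧
      ∀ s t : ℝ, 1 < s → s < t →
        HyperbolicCantor.E lam .smooth ⊂ HyperbolicCantor.E lam (.finite t) ∧
        HyperbolicCantor.E lam (.finite t) ⊂ HyperbolicCantor.E lam (.finite s) ∧
        HyperbolicCantor.E lam (.finite s) ⊂ HyperbolicCantor.E lam (.finite 1)) ∧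
    -- so do the equivalence classes of the self-similar Cantor set
    (∀ X : Set ℝ, HyperbolicCantor.IsAttractor (HyperbolicCantor.selfSimilarIFS lam) X →
      HyperbolicCantor.equivClass lam .analytic X ⊂ HyperbolicCantor.equivClass lam .smooth X ∧
      ∀ s t : ℝ, 1 < s → s < t →
        HyperbolicCantor.equivClass lam .smooth X ⊂
          HyperbolicCantor.equivClass lam (.finite t) X ∧
        HyperbolicCantor.equivClass lam (.finite t) X ⊂
          HyperbolicCantor.equivClass lam (.finite s) X ∧
        HyperbolicCantor.equivClass lam (.finite s) X ⊂
          HyperbolicCantor.equivClass lam (.finite 1) X) ∧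
    -- a constant scaling function does not force higher regularity
    (∀ s t : ℝ, 1 < s → s < t →
      ∃ X ∈ HyperbolicCantor.E lam (.finite s),
        ¬ HyperbolicCantor.IsHyperbolicCantorSet (.finite t) X) := by
  obtain ⟨X, hX⟩ := HyperbolicCantor.exists_isAttractor_selfSimilarIFS hlam₀ hlam₁
  refine ⟨⟨(HyperbolicCantor.analytic_ssubset_smooth hlam₀ hlam₁ hX).1, fun s t hs hst =>
    ⟨(HyperbolicCantor.smooth_ssubset_finite hlam₀ hlam₁ hX (hs.trans hst)).1,
      (HyperbolicCantor.finite_ssubset_finite hlam₀ hlam₁ hX hs hst).1,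
      (HyperbolicCantor.finite_ssubset_one hlam₀ hlam₁ hX hs).1⟩⟩, fun X hX =>
    ⟨(HyperbolicCantor.analytic_ssubset_smooth hlam₀ hlam₁ hX).2, fun s t hs hst =>
      ⟨(HyperbolicCantor.smooth_ssubset_finite hlam₀ hlam₁ hX (hs.trans hst)).2,
        (HyperbolicCantor.finite_ssubset_finite hlam₀ hlam₁ hX hs hst).2,
        (HyperbolicCantor.finite_ssubset_one hlam₀ hlam₁ hX hs).2⟩⟩, fun s t hs hst => ?_⟩
  obtain ⟨Y, hY, hn⟩ := HyperbolicCantor.exists_mem_equivClass_not_finite hlam₀ hlam₁ hX hs hst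
  exact ⟨Y, hY.1, hn⟩
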